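/- **Setting.** Let $X\subseteq\mathbb R^d$ be a set on which derivatives are uniquely determined (for instance $X=\mathbb R^d$, or a compact convex set with nonempty interior), and let $\mathcal P(X)$ be the set of Borel probability measures concentrated on a compact subset of $X$ (all Borel probability measures on $X$ if $X$ is compact). Let $c:\mathbb R^d\times\mathbb R^d\to\mathbb R$ be a symmetric cost of class $C^1$ (for instance $c(x,y)=\|x-y\|^2$), let $\varepsilon>0$, and let $\mu^*\in\mathcal P(X)$ be the target. For $\mu,\nu\in\mathcal P(X)$ put $$\mathcal W_\varepsilon(\mu,\nu)=\inf_{\pi\in\Pi(\mu,\nu)}\Big\{\int c\,d\pi+\varepsilon\,\mathrm{KL}(\pi\,|\,\mu\otimes\nu)\Big\},$$ where $\Pi(\mu,\nu)$ is the set of couplings of $\mu$ and $\nu$, and let $$\mathcal F_\varepsilon(\mu)=\mathcal W_\varepsilon(\mu,\mu^*)-\tfrac12\mathcal W_\varepsilon(\mu,\mu)-\tfrac12\mathcal W_\varepsilon(\mu^*,\mu^*)$$ be the Sinkhorn divergence to $\mu^*$. A first variation of $\mathcal F_\varepsilon$ at $\mu\in\mathcal P(X)$ is a function $\frac{\delta\mathcal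 F_\varepsilon(\mu)}{\delta\mu}$, integrable with respect to every $\nu\in\mathcal P(X)$, such that for every $\nu\in\mathcal P(X)$ $$\frac{d}{dr}\Big|_{r=0^+}\mathcal F_\varepsilon\big(\mu+r(\nu-\mu)\big)=\int\frac{\delta\mathcal F_\varepsilon(\mu)}{\delta\mu}\,d(\nu-\mu);$$ on $X$ it is unique up to an additive constant. Gradients of first variations are taken within $X$. Let $J\subseteq\mathbb R$ be an interval (for instance $[0,\infty)$) and let $(\mu_t)_{t\in J}$ be a Sinkhorn gradient flow, that is, a weak solution in $\mathcal P(X)$ of $$\partial_t\mu_t=\nabla\cdot\Big(\mu_t\,\nabla\frac{\delta\mathcal F_\varepsilon(\mu_t)}{\delta\mu}\Big),$$ meaning: every $t\in J$ has a neighbourhood in $J$ over which all $\mu_s$ are concentrated on one common compact subset of $X$, and for every $h\in C_c^\infty(\mathbb R^d)$ and $t\in J$, $$\frac{d}{dt}\int h\,d\mu_t=-\int\Big\langle\nabla\frac{\delta\mathcal F_\varepsilon(\mu_t)}{\delta\mu},\nabla h\Big\rangle d\mu_t .$$ (Time derivatives are one-sided at endpoints of $J$.) **Proposition (descending property).** For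 every $t\in J$ the first variation $\frac{\delta\mathcal F_\varepsilon(\mu_t)}{\delta\mu}$ exists and is differentiable on $X$, the squared norm of its gradient is $\mu_t$-integrable, $t\mapsto\mathcal F_\varepsilon(\mu_t)$ is differentiable at $t$, and $$\frac{d}{dt}\mathcal F_\varepsilon(\mu_t)=-\int\Big\|\nabla\frac{\delta\mathcal F_\varepsilon(\mu_t)}{\delta\mu}\Big\|^2d\mu_t\le 0 .$$ Consequently $t\mapsto\mathcal F_\varepsilon(\mu_t)$ is nonincreasing on $J$. -/

import Mathlib

open MeasureTheory Set Filter Topology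
open scoped ContDiff

noncomputable section

namespace Sinkhorn

/-- The Euclidean space `ℝ^d`. -/
abbrev E (d : ℕ) : Type := EuclideanSpace ℝ (Fin d)

/-- `π` is a coupling of `μ` and `ν`: its marginals are `μ` and `ν`. -/
def IsCoupling {d : ℕ} (π : Measure (E d × E d)) (μ ν : Measure (E d)) : Prop :=
  π.map Prod.fst = μ ∧ π.map Prod.snd = ν

/-- Entropy-regularized transport cost
`W_ε(μ, ν) = inf { ∫ c dπ + ε KL(π | μ ⊗ ν) : π coupling of μ and ν }`.
Couplings of infinite relative entropy do not contribute to the infimum. -/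
def entropicCost {d : ℕ} (c : E d → E d → ℝ) (ε : ℝ) (μ ν : Measure (E d)) : ℝ :=
  sInf {r : ℝ | ∃ π : Measure (E d × E d), IsCoupling π μ ν ∧
    Integrable (fun p => c p.1 p.2) π ∧
    InformationTheory.klDiv π (μ.prod ν) ≠ ⊤ ∧
    r = ∫ p, c p.1 p.2 ∂π + ε * (InformationTheory.klDiv π (μ.prod ν)).toReal}

/-- The Sinkhorn divergence to the target `μs`:
`F_ε(μ) = W_ε(μ, μs) - W_ε(μ, μ) / 2 - W_ε(μs, μs) / 2`. -/
def sinkhornDiv {d : ℕ} (c : E d → E d → ℝ) (ε : ℝ) (μs μ : Measure (E d)) : ℝ :=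
  entropicCost c ε μ μs - entropicCost c ε μ μ / 2 - entropicCost c ε μs μs / 2

/-- Borel probability measures concentrated on a compact subset of `X`
(all Borel probability measures on `X` when `X` is compact). -/
def MemP {d : ℕ} (X : Set (E d)) (μ : Measure (E d)) : Prop :=
  IsProbabilityMeasure μ ∧ ∃ K ⊆ X, IsCompact K ∧ μ Kᶜ = 0

/-- The perturbed measure `μ + r (ν - μ)`, for `0 ≤ r ≤ 1`. -/
def perturb {d : ℕ} (μ ν : Measure (E d)) (r : ℝ) : Measure (E d) :=
  ENNReal.ofReal (1 - r) • μ + ENNReal.ofReal r • ν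

/-- `φ` is a first variation of `F` at `μ`: for every perturbation `χ = ν - μ` with `ν` in `P(X)`
(up to a positive factor, these are the `χ` for which `μ + r χ` is in `P(X)` for small `r ≥ 0`),
the derivative of `r ↦ F (μ + r χ)` at `r = 0` is `∫ φ dχ`.
On `X`, this determines `φ` up to an additive constant, as one sees from Dirac masses `ν`. -/
def IsFirstVariation {d : ℕ} (X : Set (E d)) (F : Measure (E d) → ℝ) (μ : Measure (E d))
    (φ : E d → ℝ) : Prop :=
  (∀ ν, MemP X ν → Integrable φ ν) ∧
  ∀ ν, MemP X ν →
    HasDerivWithinAt (fun r : ℝ => F (perturb μ ν r)) (∫ x, φ x ∂ν - ∫ x, φ x ∂μ) (Ici 0) 0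

open Classical in
/-- The first variation `δF(μ)/δμ`, a chosen representative modulo additive constants
(the zero function if there is none). -/
def firstVariation {d : ℕ} (X : Set (E d)) (F : Measure (E d) → ℝ) (μ : Measure (E d)) :
    E d → ℝ :=
  if h : ∃ φ, IsFirstVariation X F μ φ then h.choose else 0

/-- The gradient in `X` of the first variation, `∇ (δF(μ)/δμ)`. -/
def wassersteinGrad {d : ℕ} (X : Set (E d)) (F : Measure (E d) → ℝ) (μ : Measure (E d))
    (x : E d) : E d :=
  gradientWithin (firstVariation X F μ) X x

/-- `μ` is a weak solution, over the time interval `J`, in the probability measures on `X`, of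
`∂ₜ μₜ = ∇ · (μₜ ∇ (δF(μₜ)/δμ))`, with support compact in `X` locally uniformly in time. -/
structure IsGradientFlow {d : ℕ} (X : Set (E d)) (F : Measure (E d) → ℝ) (J : Set ℝ)
    (μ : ℝ → Measure (E d)) : Prop where
  prob : ∀ t ∈ J, IsProbabilityMeasure (μ t)
  supp : ∀ t ∈ J, ∃ K ⊆ X, IsCompact K ∧ ∀ᶠ s in 𝓝[J] t, μ s Kᶜ = 0
  weak : ∀ h : E d → ℝ, ContDiff ℝ ∞ h → HasCompactSupport h → ∀ t ∈ J,
    HasDerivWithinAt (fun s => ∫ x, h x ∂(μ s))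
      (-∫ x, inner ℝ (wassersteinGrad X F (μ t) x) (gradient h x) ∂(μ t)) J t

end Sinkhorn

end

/-! Formally, the chain rule gives `dF(μ_t)/dt = ∫ (δF/δμ) d(∂_t μ_t) = -∫ ‖∇ δF/δμ‖² dμ_t`. The
work lies in justifying it for a functional defined by an infimum, along a curve that is only a weak
solution, with a cost that is only `C¹`.

Distances between measures are taken in the norm dual to `C¹` on a compact set (`DualClose`). The
gradient of a Schrödinger potential is an average of `∇ₓ c`, so it is bounded on compact sets
independently of the measures. The velocity of the flow is thus bounded, and the flow is locally
Lipschitz in the dual norm (`IsGradientFlow.exists_dualClose`).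

In that norm the entropic cost has a first-order expansion at `(μ₀, ν₀)`. Let `f`, `g` be potentials
there, `G = exp ((f + g - c) / ε)`, and let `m` be the mass of `G` under `μ ⊗ ν`, with `μ`, `ν` at
distance at most `r` from `μ₀`, `ν₀`. Weak duality with `f`, `g` kept fixed bounds the cost below by
`∫ f dμ + ∫ g dν - ε (m - 1)`. Correcting `G` into the density of an exact coupling gives the same
upper bound up to `O(r²)` (`IsPotential.abs_entropicCost_sub_le`). Since `G` has unit marginals at
the base point, `m - 1` is the integral of `G` against `(μ - μ₀) ⊗ (ν - ν₀)`, which is `o(r)`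
(`exists_bound_second_difference`). No stability of the potentials in the measures is needed.

Hence an explicit `C¹` function `φ` linearizes the divergence at `μ_t` (`exists_isLinearization`);
it is a first variation, and the weak equation may be tested with it
(`hasDerivWithinAt_integral_of_weak`), which gives the formula. -/

namespace Sinkhorn

/-! ### Relative entropy: the Gibbs inequality and measures with a density. -/

section RelativeEntropy

variable {α : Type*} [MeasurableSpace α]

/-- Young's inequality for the relative entropy integrand. -/
lemma mul_le_klFun_add_exp {ρ : ℝ} (hρ : 0 ≤ ρ) (u : ℝ) :
    ρ * u ≤ InformationTheory.klFun ρ + Real.exp u - 1 := by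
  rw [InformationTheory.klFun]
  rcases hρ.eq_or_lt with rfl | hρ
  · have := Real.exp_pos u
    simp; linarith
  · have h := Real.add_one_le_exp (u - Real.log ρ)
    rw [Real.exp_sub, Real.exp_log hρ, le_div_iff₀ hρ] at h
    nlinarith

/-- The Gibbs (Donsker-Varadhan) inequality. -/
lemma integral_le_klDiv_add_integral_exp {P Q : Measure α} [IsFiniteMeasure P]
    [IsProbabilityMeasure Q] (hkl : InformationTheory.klDiv P Q ≠ ⊤) {u : α → ℝ}
    (hu : Integrable u P) (hexp : Integrable (fun x => Real.exp (u x)) Q) :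
    ∫ x, u x ∂P ≤ (InformationTheory.klDiv P Q).toReal + (∫ x, Real.exp (u x) ∂Q - 1) := by
  obtain ⟨hac, hllr⟩ := InformationTheory.klDiv_ne_top_iff.1 hkl
  have hk := (InformationTheory.integrable_klFun_rnDeriv_iff hac).2 hllr
  have hu' : Integrable (fun x => (P.rnDeriv Q x).toReal • u x) Q :=
    (integrable_rnDeriv_smul_iff hac).2 hu
  have hi : Integrable (fun x => Real.exp (u x) - 1) Q := hexp.sub (integrable_const 1)
  have h1 : ∫ x, (Real.exp (u x) - 1) ∂Q = ∫ x, Real.exp (u x) ∂Q - 1 := by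
    rw [integral_sub hexp (integrable_const 1)]; simp
  rw [← integral_rnDeriv_smul hac, InformationTheory.toReal_klDiv_eq_integral_klFun hac, ← h1,
    ← integral_add hk hi]
  refine integral_mono hu' (hk.add hi) fun x => ?_
  have := mul_le_klFun_add_exp (ENNReal.toReal_nonneg (a := P.rnDeriv Q x)) (u x)
  simp only [smul_eq_mul]
  linarith

lemma integral_withDensity_ofReal {Q : Measure α} {D : α → ℝ} (hD : Measurable D)
    (hpos : ∀ᵐ x ∂Q, 0 < D x) (u : α → ℝ) :
    ∫ x, u x ∂(Q.withDensity fun x => ENNReal.ofReal (D x)) = ∫ x, D x * u x ∂Q := by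
  rw [integral_withDensity_eq_integral_toReal_smul (by fun_prop) (by simp)]
  refine integral_congr_ae ?_
  filter_upwards [hpos] with x hx
  simp [ENNReal.toReal_ofReal hx.le]

lemma integrable_withDensity_ofReal {Q : Measure α} {D : α → ℝ} (hD : Measurable D)
    (hpos : ∀ᵐ x ∂Q, 0 < D x) {u : α → ℝ} :
    Integrable u (Q.withDensity fun x => ENNReal.ofReal (D x)) ↔
      Integrable (fun x => D x * u x) Q := by
  rw [integrable_withDensity_iff_integrable_smul' (by fun_prop) (by simp)]
  refine integrable_congr ?_
  filter_upwards [hpos] with x hx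
  simp [ENNReal.toReal_ofReal hx.le]

lemma klDiv_withDensity_ofReal {Q : Measure α} [IsProbabilityMeasure Q] {D : α → ℝ}
    (hD : Measurable D) (hpos : ∀ᵐ x ∂Q, 0 < D x)
    (hprob : IsProbabilityMeasure (Q.withDensity fun x => ENNReal.ofReal (D x)))
    (hlog : Integrable (fun x => D x * Real.log (D x)) Q) :
    InformationTheory.klDiv (Q.withDensity fun x => ENNReal.ofReal (D x)) Q ≠ ⊤ ∧
    (InformationTheory.klDiv (Q.withDensity fun x => ENNReal.ofReal (D x)) Q).toReal =
      ∫ x, D x * Real.log (D x) ∂Q := by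
  set P := Q.withDensity fun x => ENNReal.ofReal (D x) with hP
  have hac : P ≪ Q := withDensity_absolutelyContinuous _ _
  have hll : llr P Q =ᵐ[P] fun x => Real.log (D x) := by
    have h := hac.ae_le (Measure.rnDeriv_withDensity Q (f := fun x => ENNReal.ofReal (D x))
      (by fun_prop))
    filter_upwards [h, hac.ae_le hpos] with x hx hx'
    rw [llr, hx, ENNReal.toReal_ofReal hx'.le]
  have hint : Integrable (llr P Q) P := by
    rw [integrable_congr hll]
    exact (integrable_withDensity_ofReal hD hpos).2 hlog
  refine ⟨InformationTheory.klDiv_ne_top hac hint, ?_⟩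
  rw [InformationTheory.toReal_klDiv_of_measure_eq hac (by simp), integral_congr_ae hll,
    integral_withDensity_ofReal hD hpos]

end RelativeEntropy

/-! ### Measures concentrated on a compact set. -/

lemma ae_mem_of_compl_null {α : Type*} [MeasurableSpace α] {μ : Measure α} {K : Set α} (hμ : μ Kᶜ = 0) : ∀ᵐ x ∂μ, x ∈ K :=
  measure_eq_zero_iff_ae_notMem.1 hμ |>.mono fun _ hx => not_not.1 hx

lemma restrict_eq_of_compl_null {α : Type*} [MeasurableSpace α] {μ : Measure α} {K : Set α} (hμ : μ Kᶜ = 0) :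
    μ.restrict K = μ :=
  Measure.restrict_eq_self_of_ae_mem (ae_mem_of_compl_null hμ)

section CompactlySupported

variable {α : Type*} [TopologicalSpace α] [MeasurableSpace α] [OpensMeasurableSpace α]
  {F : Type*} [NormedAddCommGroup F]

lemma integrable_of_continuous [T2Space α] [SecondCountableTopologyEither α F] {μ : Measure α}
    [IsFiniteMeasure μ] {K : Set α} (hK : IsCompact K) (hμ : μ Kᶜ = 0) {h : α → F}
    (hh : Continuous h) : Integrable h μ := by
  obtain ⟨M, hM⟩ := hK.exists_bound_of_continuousOn hh.continuousOn
  refine Integrable.mono' (integrable_const M) ?_ ((ae_mem_of_compl_null hμ).mono hM)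
  rw [← restrict_eq_of_compl_null hμ]
  exact hh.continuousOn.aestronglyMeasurable_of_isCompact hK hK.measurableSet

end CompactlySupported

lemma prod_compl_null {α β : Type*} [MeasurableSpace α] [MeasurableSpace β] {μ : Measure α}
    {ν : Measure β} [SFinite μ] [SFinite ν] {K : Set α} {L : Set β}
    (hμ : μ Kᶜ = 0) (hν : ν Lᶜ = 0) : (μ.prod ν) (K ×ˢ L)ᶜ = 0 := by
  rw [compl_prod_eq_union]
  refine measure_union_null ?_ ?_ <;> rw [Measure.prod_prod] <;> simp [hμ, hν]

/-! ### Lower and upper bounds for the entropic cost. -/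

section Cost

variable {d : ℕ} {c : E d → E d → ℝ} {ε : ℝ} {μ ν : Measure (E d)} {K : Set (E d)}

lemma IsCoupling.integral_fst {π : Measure (E d × E d)} (h : IsCoupling π μ ν) {f : E d → ℝ}
    (hf : Continuous f) : ∫ p, f p.1 ∂π = ∫ x, f x ∂μ := by
  rw [← h.1, integral_map (by fun_prop) hf.aestronglyMeasurable]

lemma IsCoupling.integral_snd {π : Measure (E d × E d)} (h : IsCoupling π μ ν) {f : E d → ℝ}
    (hf : Continuous f) : ∫ p, f p.2 ∂π = ∫ x, f x ∂ν := by
  rw [← h.2, integral_map (by fun_prop) hf.aestronglyMeasurable]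

/-- This is `ε` times the Gibbs inequality for `π` against `μ ⊗ ν`, with exponent `u = (f + g - c) /
ε`. -/
lemma dual_le_of_coupling (hc : Continuous (Function.uncurry c)) (hε : 0 < ε)
    [IsProbabilityMeasure μ] [IsProbabilityMeasure ν] (hK : IsCompact K)
    (hμ : μ Kᶜ = 0) (hν : ν Kᶜ = 0) {f g : E d → ℝ} (hf : Continuous f) (hg : Continuous g)
    {π : Measure (E d × E d)} (hπ : IsCoupling π μ ν) (hci : Integrable (fun p => c p.1 p.2) π)
    (hkl : InformationTheory.klDiv π (μ.prod ν) ≠ ⊤) :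
    ∫ x, f x ∂μ + ∫ y, g y ∂ν
        - ε * (∫ p, Real.exp ((f p.1 + g p.2 - c p.1 p.2) / ε) ∂(μ.prod ν) - 1)
      ≤ ∫ p, c p.1 p.2 ∂π + ε * (InformationTheory.klDiv π (μ.prod ν)).toReal := by
  have hc' : Continuous fun p : E d × E d => c p.1 p.2 := hc
  have : IsProbabilityMeasure π := by
    have : IsProbabilityMeasure (π.map Prod.fst) := by rw [hπ.1]; infer_instance
    exact Measure.isProbabilityMeasure_of_map Prod.fst
  have hfi : Integrable (fun p : E d × E d => f p.1) π :=
    Integrable.comp_measurable (g := f) (by rw [hπ.1]; exact integrable_of_continuous hK hμ hf)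
      measurable_fst
  have hgi : Integrable (fun p : E d × E d => g p.2) π :=
    Integrable.comp_measurable (g := g) (by rw [hπ.2]; exact integrable_of_continuous hK hν hg)
      measurable_snd
  have hfg : Integrable (fun p : E d × E d => f p.1 + g p.2) π := hfi.add hgi
  have hu : Integrable (fun p : E d × E d => (f p.1 + g p.2 - c p.1 p.2) / ε) π :=
    (hfg.sub hci).div_const ε
  have hexp : Integrable (fun p : E d × E d => Real.exp ((f p.1 + g p.2 - c p.1 p.2) / ε))
      (μ.prod ν) :=
    integrable_of_continuous (hK.prod hK) (prod_compl_null hμ hν) (by fun_prop)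
  have h := integral_le_klDiv_add_integral_exp hkl hu hexp
  rw [integral_div, integral_sub hfg hci, integral_add hfi hgi, hπ.integral_fst hf,
    hπ.integral_snd hg, div_le_iff₀ hε] at h
  linarith

lemma bddBelow_costs (hc : Continuous (Function.uncurry c)) (hε : 0 < ε)
    [IsProbabilityMeasure μ] [IsProbabilityMeasure ν] (hK : IsCompact K)
    (hμ : μ Kᶜ = 0) (hν : ν Kᶜ = 0) :
    BddBelow {r : ℝ | ∃ π : Measure (E d × E d), IsCoupling π μ ν ∧
      Integrable (fun p => c p.1 p.2) π ∧ InformationTheory.klDiv π (μ.prod ν) ≠ ⊤ ∧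
      r = ∫ p, c p.1 p.2 ∂π + ε * (InformationTheory.klDiv π (μ.prod ν)).toReal} := by
  refine ⟨∫ x, (0 : ℝ) ∂μ + ∫ y, (0 : ℝ) ∂ν
    - ε * (∫ p, Real.exp ((0 + 0 - c p.1 p.2) / ε) ∂(μ.prod ν) - 1), ?_⟩
  rintro r ⟨π, hπ, hci, hkl, rfl⟩
  exact dual_le_of_coupling hc hε hK hμ hν (f := fun _ => 0) (g := fun _ => 0)
    continuous_const continuous_const hπ hci hkl

/-- Weak duality for the entropic cost. -/
lemma dual_le_entropicCost (hc : Continuous (Function.uncurry c)) (hε : 0 < ε)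
    [IsProbabilityMeasure μ] [IsProbabilityMeasure ν] (hK : IsCompact K)
    (hμ : μ Kᶜ = 0) (hν : ν Kᶜ = 0) {f g : E d → ℝ} (hf : Continuous f) (hg : Continuous g) :
    ∫ x, f x ∂μ + ∫ y, g y ∂ν
        - ε * (∫ p, Real.exp ((f p.1 + g p.2 - c p.1 p.2) / ε) ∂(μ.prod ν) - 1)
      ≤ entropicCost c ε μ ν := by
  refine le_csInf ⟨_, μ.prod ν, ⟨?_, ?_⟩, ?_, ?_, rfl⟩ ?_
  · simp
  · simp
  · exact integrable_of_continuous (hK.prod hK) (prod_compl_null hμ hν) hc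
  · simp
  · rintro r ⟨π, hπ, hci, hkl, rfl⟩
    exact dual_le_of_coupling hc hε hK hμ hν hf hg hπ hci hkl

lemma isCoupling_withDensity [IsProbabilityMeasure μ] [IsProbabilityMeasure ν]
    {D : E d × E d → ℝ} (hD : Continuous D) (hK : IsCompact K) (hμ : μ Kᶜ = 0) (hν : ν Kᶜ = 0)
    (hpos : ∀ x ∈ K, ∀ y ∈ K, 0 < D (x, y))
    (h1 : ∀ x ∈ K, ∫ y, D (x, y) ∂ν = 1) (h2 : ∀ y ∈ K, ∫ x, D (x, y) ∂μ = 1) :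
    IsCoupling ((μ.prod ν).withDensity fun p => ENNReal.ofReal (D p)) μ ν := by
  have hm : Measurable fun p : E d × E d => ENNReal.ofReal (D p) := by fun_prop
  have key : ∀ {ρ : Measure (E d)} [IsProbabilityMeasure ρ], ρ Kᶜ = 0 → ∀ {u : E d → ℝ},
      Continuous u → (∀ y ∈ K, 0 < u y) → ∫ y, u y ∂ρ = 1 → ∫⁻ y, ENNReal.ofReal (u y) ∂ρ = 1 := by
    intro ρ _ hρ u hu hu0 h
    rw [← ofReal_integral_eq_lintegral_ofReal (integrable_of_continuous hK hρ hu)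
      ((ae_mem_of_compl_null hρ).mono fun y hy => (hu0 y hy).le), h, ENNReal.ofReal_one]
  constructor
  · ext s hs
    rw [Measure.map_apply measurable_fst hs, withDensity_apply _ (measurable_fst hs),
      ← lintegral_indicator (measurable_fst hs),
      lintegral_prod _ (hm.indicator (measurable_fst hs)).aemeasurable]
    have : ∀ᵐ x ∂μ, ∫⁻ y, (Prod.fst ⁻¹' s).indicator (fun p => ENNReal.ofReal (D p)) (x, y) ∂ν
        = s.indicator 1 x := by
      filter_upwards [ae_mem_of_compl_null hμ] with x hx
      by_cases hxs : x ∈ s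
      · simp only [indicator, mem_preimage, hxs, if_true, Pi.one_apply]
        exact key hν (by fun_prop) (hpos x hx) (h1 x hx)
      · simp [indicator, hxs]
    rw [lintegral_congr_ae this, lintegral_indicator_one hs]
  · ext s hs
    rw [Measure.map_apply measurable_snd hs, withDensity_apply _ (measurable_snd hs),
      ← lintegral_indicator (measurable_snd hs),
      lintegral_prod_symm _ (hm.indicator (measurable_snd hs)).aemeasurable]
    have : ∀ᵐ y ∂ν, ∫⁻ x, (Prod.snd ⁻¹' s).indicator (fun p => ENNReal.ofReal (D p)) (x, y) ∂μ
        = s.indicator 1 y := by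
      filter_upwards [ae_mem_of_compl_null hν] with y hy
      by_cases hys : y ∈ s
      · simp only [indicator, mem_preimage, hys, if_true, Pi.one_apply]
        exact key hμ (by fun_prop) (fun x hx => hpos x hx y hy) (h2 y hy)
      · simp [indicator, hys]
    rw [lintegral_congr_ae this, lintegral_indicator_one hs]

/-- A coupling with positive continuous density bounds the entropic cost from above. -/
lemma entropicCost_le_of_density (hc : Continuous (Function.uncurry c)) (hε : 0 < ε)
    [IsProbabilityMeasure μ] [IsProbabilityMeasure ν]
    {D : E d × E d → ℝ} (hD : Continuous D) (hK : IsCompact K) (hμ : μ Kᶜ = 0) (hν : ν Kᶜ = 0)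
    (hpos : ∀ x ∈ K, ∀ y ∈ K, 0 < D (x, y))
    (h1 : ∀ x ∈ K, ∫ y, D (x, y) ∂ν = 1) (h2 : ∀ y ∈ K, ∫ x, D (x, y) ∂μ = 1) :
    entropicCost c ε μ ν ≤ ∫ p, D p * c p.1 p.2 ∂(μ.prod ν)
      + ε * ∫ p, D p * Real.log (D p) ∂(μ.prod ν) := by
  have hc' : Continuous fun p : E d × E d => c p.1 p.2 := hc
  have hcoup := isCoupling_withDensity hD hK hμ hν hpos h1 h2
  have hae : ∀ᵐ p ∂(μ.prod ν), 0 < D p := by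
    filter_upwards [ae_mem_of_compl_null (prod_compl_null hμ hν)] with p hp
    exact hpos p.1 hp.1 p.2 hp.2
  have hlog : Integrable (fun p => D p * Real.log (D p)) (μ.prod ν) :=
    integrable_of_continuous (hK.prod hK) (prod_compl_null hμ hν)
      (Real.continuous_mul_log.comp hD)
  have hprob : IsProbabilityMeasure
      ((μ.prod ν).withDensity fun p => ENNReal.ofReal (D p)) := by
    have : IsProbabilityMeasure
        (((μ.prod ν).withDensity fun p => ENNReal.ofReal (D p)).map Prod.fst) := by
      rw [hcoup.1]; infer_instance
    exact Measure.isProbabilityMeasure_of_map Prod.fst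
  obtain ⟨hkl, hkl'⟩ := klDiv_withDensity_ofReal hD.measurable hae hprob hlog
  refine csInf_le (bddBelow_costs hc hε hK hμ hν) ⟨_, hcoup, ?_, hkl, ?_⟩
  · exact (integrable_withDensity_ofReal hD.measurable hae).2
      (integrable_of_continuous (hK.prod hK) (prod_compl_null hμ hν) (by fun_prop))
  · rw [hkl', integral_withDensity_ofReal hD.measurable hae]

end Cost

end Sinkhorn

namespace Sinkhorn

/-! ### Schrödinger potentials on compact spaces, by contraction of the Sinkhorn iteration. -/

section SoftTransform

variable {X Y : Type*} [TopologicalSpace X] [CompactSpace X] [TopologicalSpace Y] [CompactSpace Y]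
  [FirstCountableTopology X] [T2Space X] [MeasurableSpace Y] [OpensMeasurableSpace Y]

lemma integrable_continuousMap_exp (ν : Measure Y) [IsFiniteMeasure ν] (u : C(Y, ℝ)) :
    Integrable (fun y => Real.exp (u y)) ν :=
  (by fun_prop : Continuous fun y => Real.exp (u y)).integrable_of_hasCompactSupport
    (HasCompactSupport.of_compactSpace _)

lemma integral_continuousMap_exp_pos (ν : Measure Y) [IsProbabilityMeasure ν] (u : C(Y, ℝ)) :
    0 < ∫ y, Real.exp (u y) ∂ν :=
  integral_exp_pos (integrable_continuousMap_exp ν u)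

/-- Log-integral-exp is monotone and commutes with adding constants; the oscillation and Lipschitz
bounds on the soft transform follow from this alone. -/
lemma log_integral_exp_le (ν : Measure Y) [IsProbabilityMeasure ν] (u v : C(Y, ℝ)) (a : ℝ)
    (h : ∀ y, u y ≤ v y + a) :
    Real.log (∫ y, Real.exp (u y) ∂ν) ≤ Real.log (∫ y, Real.exp (v y) ∂ν) + a := by
  rw [← Real.log_exp a, ← Real.log_mul (integral_continuousMap_exp_pos ν v).ne'
    (Real.exp_pos a).ne', ← integral_mul_const]
  refine Real.log_le_log (integral_continuousMap_exp_pos ν u) ?_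
  refine integral_mono (integrable_continuousMap_exp ν u)
    ((integrable_continuousMap_exp ν v).mul_const _) fun y => ?_
  rw [← Real.exp_add]
  exact Real.exp_le_exp.2 (h y)

/-- The section `y ↦ g y - c (x, y)`. -/
noncomputable def reducedCost (c : C(X × Y, ℝ)) (g : C(Y, ℝ)) (x : X) : C(Y, ℝ) :=
  ⟨fun y => g y - c (x, y), by fun_prop⟩

/-- The soft `c`-transform `x ↦ - log ∫ exp (g y - c (x, y)) dν(y)`. -/
noncomputable def softTransform (c : C(X × Y, ℝ)) (ν : Measure Y) [IsProbabilityMeasure ν] (g : C(Y, ℝ)) :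
    C(X, ℝ) where
  toFun x := -Real.log (∫ y, Real.exp (reducedCost c g x y) ∂ν)
  continuous_toFun := by
    have h : Continuous fun x => ∫ y, Real.exp (reducedCost c g x y) ∂ν := by
      have := continuous_parametric_integral_of_continuous (μ := ν)
        (f := fun (x : X) (y : Y) => Real.exp (g y - c (x, y)))
        (by simp only [Function.uncurry_def]; fun_prop) isCompact_univ
      simpa [reducedCost] using this
    exact (h.log fun x => (integral_continuousMap_exp_pos ν _).ne').neg

variable (c : C(X × Y, ℝ)) (ν : Measure Y) [IsProbabilityMeasure ν]

lemma softTransform_apply (g : C(Y, ℝ)) (x : X) :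
    softTransform c ν g x = -Real.log (∫ y, Real.exp (reducedCost c g x y) ∂ν) := rfl

lemma exp_neg_softTransform (g : C(Y, ℝ)) (x : X) :
    Real.exp (-softTransform c ν g x) = ∫ y, Real.exp (g y - c (x, y)) ∂ν := by
  rw [softTransform_apply, neg_neg, Real.exp_log (integral_continuousMap_exp_pos ν _)]
  rfl

/-- The bound does not depend on `g`, so a single application of the transform lands in functions of
oscillation at most `2 * B`; this starts the iteration. -/
lemma softTransform_sub_le {B : ℝ} (hB : ∀ p, |c p| ≤ B) (g : C(Y, ℝ)) (x x' : X) :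
    softTransform c ν g x - softTransform c ν g x' ≤ 2 * B := by
  have := log_integral_exp_le ν (reducedCost c g x') (reducedCost c g x) (2 * B) fun y => by
    have h1 := abs_le.1 (hB (x, y)); have h2 := abs_le.1 (hB (x', y))
    simp only [reducedCost, ContinuousMap.coe_mk]; linarith
  simp only [softTransform_apply]; linarith

lemma softTransform_le {g g' : C(Y, ℝ)} {a : ℝ} (h : ∀ y, g' y ≤ g y + a) (x : X) :
    softTransform c ν g x ≤ softTransform c ν g' x + a := by
  have := log_integral_exp_le ν (reducedCost c g' x) (reducedCost c g x) a fun y => by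
    have := h y
    simp only [reducedCost, ContinuousMap.coe_mk]; linarith
  simp only [softTransform_apply]; linarith

lemma dist_softTransform_le (g g' : C(Y, ℝ)) :
    dist (softTransform c ν g) (softTransform c ν g') ≤ dist g g' := by
  rw [ContinuousMap.dist_le dist_nonneg]
  intro x
  have h : ∀ y, |g y - g' y| ≤ dist g g' := fun y => by
    rw [← Real.dist_eq]; exact ContinuousMap.dist_apply_le_dist y
  rw [Real.dist_eq, abs_le]
  have h1 := softTransform_le c ν (g := g) (g' := g') (a := dist g g')
    (fun y => by have := (abs_le.1 (h y)).1; linarith) x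
  have h2 := softTransform_le c ν (g := g') (g' := g) (a := dist g g')
    (fun y => by have := (abs_le.1 (h y)).2; linarith) x
  constructor <;> linarith

/-- Turns the averaging gain, which appears inside exponentials, into a linear contraction factor.
It rests on `δ exp δ ≤ (exp δ - 1) (1 + δ)`, a form of `1 + δ ≤ exp δ`. -/
lemma mix_exp_le {κ δ R : ℝ} (hκ : 0 ≤ κ) (hδ : 0 ≤ δ) (hR : δ ≤ R) :
    (1 - κ) * Real.exp δ + κ ≤ Real.exp ((1 - κ / (1 + R)) * δ) := by
  have h1 : Real.exp ((1 - κ / (1 + R)) * δ) = Real.exp δ * Real.exp (-(κ / (1 + R) * δ)) := by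
    rw [← Real.exp_add]; ring_nf
  have h2 := Real.add_one_le_exp (-(κ / (1 + R) * δ))
  have h3 := Real.add_one_le_exp δ
  have h0 := Real.exp_pos δ
  have h4 : κ / (1 + R) * δ * Real.exp δ ≤ κ * (Real.exp δ - 1) := by
    have : δ * Real.exp δ ≤ (Real.exp δ - 1) * (1 + R) := by
      nlinarith [Real.exp_pos δ]
    rw [div_mul_eq_mul_div, div_mul_eq_mul_div, div_le_iff₀ (by linarith)]
    nlinarith
  rw [h1]
  nlinarith

/-- The soft transform contracts the oscillation of differences. -/
lemma softTransform_contract {B R δ : ℝ} (hB : ∀ p, |c p| ≤ B) (hδ : 0 ≤ δ) (hR : δ ≤ R)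
    {g g' : C(Y, ℝ)} (h : ∀ y y', (g' y - g y) - (g' y' - g y') ≤ δ) (x x' : X) :
    (softTransform c ν g x - softTransform c ν g' x)
      - (softTransform c ν g x' - softTransform c ν g' x')
      ≤ (1 - Real.exp (-(4 * B)) / (1 + R)) * δ := by
  set κ := Real.exp (-(4 * B)) with hκ
  have : Nonempty Y := nonempty_of_isProbabilityMeasure ν
  obtain ⟨y0, -, hy0⟩ := isCompact_univ.exists_isMaxOn univ_nonempty
    (by fun_prop : Continuous fun y => g' y - g y).continuousOn
  have hmax : ∀ y, g' y - g y ≤ g' y0 - g y0 := fun y => hy0 (mem_univ y)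
  set N := g' y0 - g y0
  have hint : ∀ u : Y → ℝ, Continuous u → Integrable u ν := fun u hu =>
    hu.integrable_of_hasCompactSupport (HasCompactSupport.of_compactSpace _)
  -- `w z` is a probability density for `ν`, and `A z` below is the `w z`-average of `exp (g' - g)`.
  -- Averages under two comparable densities are closer together than the range of the averaged
  -- function.
  set w : X → Y → ℝ := fun z y => Real.exp (softTransform c ν g z + g y - c (z, y)) with hw
  have hw1 : ∀ z, ∫ y, w z y ∂ν = 1 := fun z => by
    have : ∀ y, w z y = Real.exp (softTransform c ν g z) * Real.exp (g y - c (z, y)) := fun y => by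
      rw [← Real.exp_add]; simp only [hw]; ring_nf
    simp_rw [this]
    rw [integral_const_mul, ← exp_neg_softTransform, ← Real.exp_add]; simp
  set A : X → ℝ := fun z => Real.exp (softTransform c ν g z - softTransform c ν g' z) with hA
  have hA1 : ∀ z, ∫ y, w z y * Real.exp (g' y - g y) ∂ν = A z := fun z => by
    have : ∀ y, w z y * Real.exp (g' y - g y)
        = Real.exp (softTransform c ν g z) * Real.exp (g' y - c (z, y)) := fun y => by
      simp only [hw]; rw [← Real.exp_add, ← Real.exp_add]; ring_nf
    simp_rw [this]
    rw [integral_const_mul, ← exp_neg_softTransform, ← Real.exp_add]; rfl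
  have hA2 : ∀ z, ∫ y, w z y * (Real.exp N - Real.exp (g' y - g y)) ∂ν = Real.exp N - A z := by
    intro z
    simp_rw [mul_sub]
    rw [integral_sub (hint _ (by fun_prop)) (hint _ (by fun_prop)), hA1, integral_mul_const, hw1,
      one_mul]
  -- The densities at `x` and `x'` are comparable with factor `exp (-4B)`: `2B` comes from the cost
  -- and `2B` from the oscillation of the transform.
  have hcmp : κ * (Real.exp N - A x') ≤ Real.exp N - A x := by
    rw [← hA2, ← hA2, ← integral_const_mul]
    refine integral_mono (hint _ (by fun_prop)) (hint _ (by fun_prop)) fun y => ?_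
    have h1 : κ * w x' y ≤ w x y := by
      simp only [hκ, hw]
      rw [← Real.exp_add]
      refine Real.exp_le_exp.2 ?_
      have h1 := abs_le.1 (hB (x, y)); have h2 := abs_le.1 (hB (x', y))
      have h3 := softTransform_sub_le c ν hB g x' x
      linarith
    have h2 : 0 ≤ Real.exp N - Real.exp (g' y - g y) := sub_nonneg.2 (Real.exp_le_exp.2 (hmax y))
    calc κ * (w x' y * (Real.exp N - Real.exp (g' y - g y)))
        = κ * w x' y * (Real.exp N - Real.exp (g' y - g y)) := by ring
      _ ≤ _ := mul_le_mul_of_nonneg_right h1 h2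
  have hlow : Real.exp N ≤ Real.exp δ * A x' := by
    rw [← hA1, ← integral_const_mul]
    have : Real.exp N = ∫ y, w x' y * Real.exp N ∂ν := by
      rw [integral_mul_const, hw1, one_mul]
    rw [this]
    refine integral_mono (hint _ (by fun_prop)) (hint _ (by fun_prop)) fun y => ?_
    have h1 : Real.exp N ≤ Real.exp δ * Real.exp (g' y - g y) := by
      rw [← Real.exp_add]
      exact Real.exp_le_exp.2 (by have := h y0 y; simp only [N]; linarith)
    calc w x' y * Real.exp N ≤ w x' y * (Real.exp δ * Real.exp (g' y - g y)) :=
          mul_le_mul_of_nonneg_left h1 (Real.exp_pos _).le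
      _ = _ := by ring
  have hB0 : 0 ≤ B := (abs_nonneg _).trans (hB (x, y0))
  have hκ1 : κ ≤ 1 := Real.exp_le_one_iff.2 (by linarith)
  have hκ0 : 0 < κ := Real.exp_pos _
  have hA0 : 0 < A x' := Real.exp_pos _
  have hfin : A x ≤ A x' * Real.exp ((1 - κ / (1 + R)) * δ) := by
    calc A x ≤ (1 - κ) * Real.exp N + κ * A x' := by linarith
      _ ≤ (1 - κ) * (Real.exp δ * A x') + κ * A x' := by
        have := mul_le_mul_of_nonneg_left hlow (sub_nonneg.2 hκ1)
        linarith
      _ = A x' * ((1 - κ) * Real.exp δ + κ) := by ring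
      _ ≤ _ := mul_le_mul_of_nonneg_left (mix_exp_le hκ0.le hδ hR) hA0.le
  simp only [hA] at hfin
  rw [← Real.exp_add, Real.exp_le_exp] at hfin
  linarith

end SoftTransform

/-- Existence of Schrödinger potentials on compact spaces. -/
theorem exists_potentials_compact {X Y : Type*} [TopologicalSpace X] [CompactSpace X]
    [TopologicalSpace Y] [CompactSpace Y] [FirstCountableTopology X] [T2Space X]
    [FirstCountableTopology Y] [T2Space Y] [MeasurableSpace X] [OpensMeasurableSpace X]
    [MeasurableSpace Y] [OpensMeasurableSpace Y] (c : C(X × Y, ℝ))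
    (μ : Measure X) [IsProbabilityMeasure μ] (ν : Measure Y) [IsProbabilityMeasure ν] :
    ∃ (f : C(X, ℝ)) (g : C(Y, ℝ)),
      (∀ x, Real.exp (-f x) = ∫ y, Real.exp (g y - c (x, y)) ∂ν) ∧
      (∀ y, Real.exp (-g y) = ∫ x, Real.exp (f x - c (x, y)) ∂μ) := by
  have : Nonempty Y := nonempty_of_isProbabilityMeasure ν
  have : Nonempty X := nonempty_of_isProbabilityMeasure μ
  let y0 : Y := Classical.arbitrary Y
  let c' : C(Y × X, ℝ) := ⟨fun p => c (p.2, p.1), by fun_prop⟩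
  set B := ‖c‖
  have hB : ∀ p, |c p| ≤ B := fun p => c.norm_coe_le_norm p
  have hB' : ∀ p, |c' p| ≤ B := fun p => c.norm_coe_le_norm (p.2, p.1)
  have hB0 : 0 ≤ B := norm_nonneg _
  set κ := Real.exp (-(4 * B)) / (1 + 2 * B) with hκ
  have hκ0 : 0 < κ := by positivity
  have hκ1 : κ ≤ 1 := by
    rw [hκ, div_le_one (by positivity)]
    have : Real.exp (-(4 * B)) ≤ 1 := Real.exp_le_one_iff.2 (by linarith)
    linarith
  let S : C(Y, ℝ) → C(Y, ℝ) := fun g => softTransform c' μ (softTransform c ν g)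
  -- Only oscillations contract. Normalizing to vanish at `y0` turns an oscillation bound into a
  -- sup-norm bound.
  let S₀ : C(Y, ℝ) → C(Y, ℝ) := fun g => S g - ContinuousMap.const Y (S g y0)
  have hS₀ : ∀ g y, S₀ g y = S g y - S g y0 := fun g y => rfl
  have hcont : Continuous S₀ := by
    have h : Continuous S := by
      refine (LipschitzWith.of_dist_le_mul (K := 1) fun g g' => ?_).continuous
      simpa using (dist_softTransform_le c' μ _ _).trans (dist_softTransform_le c ν g g')
    refine h.sub ?_
    exact (ContinuousMap.continuous_const').comp ((continuous_eval_const y0).comp h)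
  let a : ℕ → C(Y, ℝ) := fun n => S₀^[n] 0
  have ha : ∀ n, a (n + 1) = S₀ (a n) := fun n => Function.iterate_succ_apply' S₀ n 0
  have ha0 : ∀ n, a n y0 = 0 := fun n => by
    cases n with
    | zero => rfl
    | succ n => rw [ha, hS₀, sub_self]
  have hosc : ∀ n y y', (a (n + 1) y - a n y) - (a (n + 1) y' - a n y')
      ≤ (1 - κ) ^ n * (2 * B) := by
    intro n
    induction n with
    | zero =>
      intro y y'
      have h := softTransform_sub_le c' μ hB' (softTransform c ν (a 0)) y y'
      have h0 : ∀ y, a 0 y = 0 := fun y => rfl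
      rw [ha, hS₀, hS₀, h0, h0]
      simp only [S]
      linarith
    | succ n ih =>
      intro y y'
      have hk : (1 - κ) ^ n ≤ 1 := pow_le_one₀ (by linarith) (by linarith)
      have hk0 : 0 ≤ (1 - κ) ^ n := pow_nonneg (by linarith) _
      have h1 := softTransform_contract c ν hB (R := 2 * B) (by positivity)
        (mul_le_of_le_one_left (by positivity) hk) ih
      -- The gain of the first half-step is discarded in the hypothesis passed here; one factor `1 -
      -- κ` per full step suffices.
      have h2 := softTransform_contract c' μ hB' (R := 2 * B) (δ := (1 - κ) ^ n * (2 * B))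
        (g := softTransform c ν (a (n + 1))) (g' := softTransform c ν (a n)) (by positivity)
        (mul_le_of_le_one_left (by positivity) hk) (fun z z' => (h1 z z').trans ?_) y y'
      · rw [ha (n + 1), hS₀, hS₀, ha n, hS₀, hS₀, ← ha n, pow_succ']
        simp only [S]
        linarith
      · exact mul_le_of_le_one_left (by positivity) (by linarith)
  have hdist : ∀ n, dist (a n) (a (n + 1)) ≤ (2 * B) * (1 - κ) ^ n := by
    intro n
    have hk0 : 0 ≤ (1 - κ) ^ n := pow_nonneg (by linarith) _
    rw [ContinuousMap.dist_le (by positivity)]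
    intro y
    have h1 := hosc n y y0
    have h2 := hosc n y0 y
    simp only [ha0] at h1 h2
    rw [Real.dist_eq, abs_le]
    constructor <;> linarith
  obtain ⟨g, hg⟩ := cauchySeq_tendsto_of_complete
    (cauchySeq_of_le_geometric (1 - κ) (2 * B) (by linarith) hdist)
  have hfix : S₀ g = g := by
    refine tendsto_nhds_unique ?_ hg
    have h1 : Tendsto (fun n => a (n + 1)) atTop (𝓝 (S₀ g)) := by
      simp_rw [ha]; exact (hcont.tendsto g).comp hg
    exact (tendsto_add_atTop_iff_nat 1).1 h1
  set f := softTransform c ν g with hf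
  set s := S g y0 with hs
  have hSg : ∀ y, softTransform c' μ f y = g y + s := fun y => by
    have := hS₀ g y
    rw [hfix] at this
    simp only [S] at this
    rw [← hf] at this
    linarith
  have hf1 : ∀ x, Real.exp (-f x) = ∫ y, Real.exp (g y - c (x, y)) ∂ν :=
    exp_neg_softTransform c ν g
  have hg1 : ∀ y, Real.exp (-(g y + s)) = ∫ x, Real.exp (f x - c (x, y)) ∂μ := fun y => by
    rw [← hSg]; exact exp_neg_softTransform c' μ f y
  -- The fixed point solves the second equation only up to the constant `s`. Integrating the kernel
  -- in both orders gives mass `1` and mass `exp (-s)`.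
  have hs0 : Real.exp (-s) = 1 := by
    have h1 : ∀ x, ∫ y, Real.exp (f x + g y - c (x, y)) ∂ν = 1 := fun x => by
      simp_rw [add_sub_assoc, Real.exp_add]
      rw [integral_const_mul, ← hf1, ← Real.exp_add]; simp
    have h2 : ∀ y, ∫ x, Real.exp (f x + g y - c (x, y)) ∂μ = Real.exp (-s) := fun y => by
      simp_rw [add_sub_right_comm, Real.exp_add]
      rw [integral_mul_const, ← hg1, ← Real.exp_add]; ring_nf
    have h3 := integral_integral_swap_of_hasCompactSupport (μ := μ) (ν := ν)
      (f := fun x y => Real.exp (f x + g y - c (x, y))) (by fun_prop)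
      (HasCompactSupport.of_compactSpace _)
    simp_rw [h1, h2] at h3
    simpa using h3.symm
  refine ⟨f, g, hf1, fun y => ?_⟩
  rw [← hg1, neg_add, Real.exp_add, hs0, mul_one]

end Sinkhorn

/-! ### Approximation in `C¹` norm on compact sets. -/

namespace Sinkhorn

/-- A `C¹` function is approximated in `C¹` norm on a compact set by test functions. -/
lemma exists_smooth_approx {V : Type*} [NormedAddCommGroup V] [NormedSpace ℝ V]
    [FiniteDimensional ℝ V] {u : V → ℝ} (hu : ContDiff ℝ 1 u) {K : Set V} (hK : IsCompact K)
    {η : ℝ} (hη : 0 < η) :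
    ∃ h : V → ℝ, ContDiff ℝ ∞ h ∧ HasCompactSupport h ∧
      (∀ x ∈ K, |u x - h x| ≤ η) ∧ ∀ x ∈ K, ‖fderiv ℝ u x - fderiv ℝ h x‖ ≤ η := by
  borelize V
  let m : Measure V := Measure.addHaar
  obtain ⟨r, hr0, hr⟩ := hK.isBounded.subset_ball_lt 0 0
  -- Cut off to a compactly supported function equal to `u` near `K`, then mollify at a scale below
  -- the moduli of continuity of both the function and its derivative.
  let χ : ContDiffBump (0 : V) := ⟨r, r + 1, hr0, by linarith⟩
  set v : V → ℝ := fun x => χ x * u x with hv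
  have hvc : ContDiff ℝ 1 v := χ.contDiff.mul hu
  have hvs : HasCompactSupport v := χ.hasCompactSupport.mul_right
  have heq : ∀ x ∈ K, v =ᶠ[𝓝 x] u := fun x hx => by
    filter_upwards [Metric.isOpen_ball.mem_nhds (hr hx)] with y hy
    simp only [hv]
    rw [χ.one_of_mem_closedBall (Metric.ball_subset_closedBall hy), one_mul]
  have hdc : Continuous (fderiv ℝ v) := hvc.continuous_fderiv (by norm_num)
  have hu1 : UniformContinuous v := hvs.uniformContinuous_of_continuous hvc.continuous
  have hu2 : UniformContinuous (fderiv ℝ v) :=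
    (hvs.fderiv ℝ).uniformContinuous_of_continuous hdc
  obtain ⟨δ1, hδ1, h1⟩ := Metric.uniformContinuous_iff.1 hu1 η hη
  obtain ⟨δ2, hδ2, h2⟩ := Metric.uniformContinuous_iff.1 hu2 η hη
  have hδ : 0 < min δ1 δ2 := lt_min hδ1 hδ2
  let ρ : ContDiffBump (0 : V) := ⟨min δ1 δ2 / 2, min δ1 δ2, by linarith, by linarith⟩
  refine ⟨convolution (ρ.normed m) v (ContinuousLinearMap.lsmul ℝ ℝ) m,
    ρ.hasCompactSupport_normed.contDiff_convolution_left _ ρ.contDiff_normed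
      hvc.continuous.locallyIntegrable,
    ρ.hasCompactSupport_normed.convolution _ hvs, fun x hx => ?_, fun x hx => ?_⟩
  · rw [← (heq x hx).self_of_nhds, abs_sub_comm, ← Real.dist_eq]
    refine ρ.dist_normed_convolution_le hvc.continuous.aestronglyMeasurable fun y hy => ?_
    exact (h1 ((Metric.mem_ball.1 hy).trans_le (min_le_left _ _))).le
  · have hd := hvs.hasFDerivAt_convolution_right (μ := m) (ContinuousLinearMap.lsmul ℝ ℝ)
      (f := ρ.normed m) ρ.continuous_normed.locallyIntegrable hvc x
    have he : (convolution (ρ.normed m) (fderiv ℝ v)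
        ((ContinuousLinearMap.lsmul ℝ ℝ).precompR V) m) x
        = (convolution (ρ.normed m) (fderiv ℝ v) (ContinuousLinearMap.lsmul ℝ ℝ) m) x := by
      refine integral_congr_ae (ae_of_all _ fun y => ?_)
      ext z
      simp [ContinuousLinearMap.precompR_apply]
    rw [hd.fderiv, he, ← (heq x hx).fderiv_eq, ← dist_eq_norm, dist_comm]
    refine ρ.dist_normed_convolution_le hdc.aestronglyMeasurable fun y hy => ?_
    exact (h2 ((Metric.mem_ball.1 hy).trans_le (min_le_right _ _))).le

/-! ### Differentiation under the integral sign. -/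

section ParametricIntegral

variable {V W : Type*} [NormedAddCommGroup V] [NormedSpace ℝ V] [FiniteDimensional ℝ V]
  [TopologicalSpace W] [T2Space W] [MeasurableSpace W] [OpensMeasurableSpace W]
  {ν : Measure W} [IsFiniteMeasure ν] {K : Set W} {G : V → W → ℝ} {G' : V → W → V →L[ℝ] ℝ}

lemma hasFDerivAt_integral_param (hK : IsCompact K) (hν : ν Kᶜ = 0)
    (hG : ∀ x, Continuous (G x)) (hG' : Continuous (Function.uncurry G'))
    (hd : ∀ x y, HasFDerivAt (fun x => G x y) (G' x y) x) (x : V) :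
    HasFDerivAt (fun x => ∫ y, G x y ∂ν) (∫ y, G' x y ∂ν) x := by
  have : SecondCountableTopology (V →L[ℝ] ℝ) := inferInstance
  obtain ⟨M, hM⟩ := ((isCompact_closedBall x 1).prod hK).exists_bound_of_continuousOn
    hG'.continuousOn
  refine hasFDerivAt_integral_of_dominated_of_fderiv_le (s := Metric.closedBall x 1)
    (bound := fun _ => M) (Metric.closedBall_mem_nhds x one_pos)
    (Eventually.of_forall fun z => (integrable_of_continuous hK hν (hG z)).1)
    (integrable_of_continuous hK hν (hG x))
    (integrable_of_continuous hK hν (hG'.comp (by fun_prop : Continuous fun y => (x, y)))).1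
    ?_ (integrable_const M) (ae_of_all _ fun y z _ => hd z y)
  filter_upwards [ae_mem_of_compl_null hν] with y hy z hz
  exact hM (z, y) ⟨hz, hy⟩

lemma contDiff_integral_param (hK : IsCompact K) (hν : ν Kᶜ = 0)
    (hG : ∀ x, Continuous (G x)) (hG' : Continuous (Function.uncurry G'))
    (hd : ∀ x y, HasFDerivAt (fun x => G x y) (G' x y) x) :
    ContDiff ℝ 1 (fun x => ∫ y, G x y ∂ν) := by
  refine contDiff_one_iff_hasFDerivAt.2 ⟨fun x => ∫ y, G' x y ∂ν, ?_,
    hasFDerivAt_integral_param hK hν hG hG' hd⟩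
  have := continuous_parametric_integral_of_continuous (μ := ν) hG' hK
  rwa [restrict_eq_of_compl_null hν] at this

end ParametricIntegral

/-! ### Schrödinger potentials on the whole space and their gradients. -/

section Potentials

variable {d : ℕ} {c : E d → E d → ℝ} {ε : ℝ} {μ ν : Measure (E d)} {K : Set (E d)}

/-- The partial derivative in the first variable of a `C¹` function on a product. -/
lemma hasFDerivAt_partial {G : E d × E d → ℝ} (hG : ContDiff ℝ 1 G) (x y : E d) :
    HasFDerivAt (fun x => G (x, y))
      ((fderiv ℝ G (x, y)).comp (ContinuousLinearMap.inl ℝ (E d) (E d))) x :=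
  ((hG.differentiable (by norm_num) (x, y)).hasFDerivAt).comp x (hasFDerivAt_prodMk_left x y)

lemma continuous_partial {G : E d × E d → ℝ} (hG : ContDiff ℝ 1 G) :
    Continuous fun p : E d × E d =>
      (fderiv ℝ G p).comp (ContinuousLinearMap.inl ℝ (E d) (E d)) :=
  (hG.continuous_fderiv (by norm_num)).clm_comp continuous_const

/-- `f` and `g` are Schrödinger potentials, normalized on the whole space. -/
structure IsPotential (c : E d → E d → ℝ) (ε : ℝ) (μ ν : Measure (E d)) (f g : E d → ℝ) :
    Prop where
  contDiff_left : ContDiff ℝ 1 f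
  contDiff_right : ContDiff ℝ 1 g
  integral_snd : ∀ x, ∫ y, Real.exp ((f x + g y - c x y) / ε) ∂ν = 1
  integral_fst : ∀ y, ∫ x, Real.exp ((f x + g y - c x y) / ε) ∂μ = 1

lemma IsPotential.swap (hsymm : ∀ x y, c x y = c y x) {f g : E d → ℝ}
    (h : IsPotential c ε μ ν f g) : IsPotential c ε ν μ g f where
  contDiff_left := h.contDiff_right
  contDiff_right := h.contDiff_left
  integral_snd x := by
    simp_rw [hsymm x, add_comm (g x)]; exact h.integral_fst x
  integral_fst y := by
    simp_rw [hsymm _ y, add_comm _ (f y)]; exact h.integral_snd y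

lemma IsPotential.contDiff_kernel (hc : ContDiff ℝ 1 (Function.uncurry c)) {f g : E d → ℝ}
    (h : IsPotential c ε μ ν f g) :
    ContDiff ℝ 1 fun p : E d × E d => Real.exp ((f p.1 + g p.2 - c p.1 p.2) / ε) := by
  have hc' : ContDiff ℝ 1 fun p : E d × E d => c p.1 p.2 := hc
  exact ((((h.contDiff_left.comp contDiff_fst).add (h.contDiff_right.comp contDiff_snd)).sub
    hc').div_const ε).exp

/-- The gradient of a potential is bounded by that of the cost. -/
lemma IsPotential.norm_fderiv_le (hc : ContDiff ℝ 1 (Function.uncurry c)) (hε : 0 < ε)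
    [IsFiniteMeasure ν] (hK : IsCompact K) (hν : ν Kᶜ = 0) {f g : E d → ℝ}
    (h : IsPotential c ε μ ν f g) {x : E d} {M : ℝ}
    (hM : ∀ y ∈ K, ‖fderiv ℝ (Function.uncurry c) (x, y)‖ ≤ M) : ‖fderiv ℝ f x‖ ≤ M := by
  set G : E d × E d → ℝ := fun p => Real.exp ((f p.1 + g p.2 - c p.1 p.2) / ε) with hG
  have hGc : ContDiff ℝ 1 G := h.contDiff_kernel hc
  set C' : E d → E d →L[ℝ] ℝ := fun y => (fderiv ℝ (Function.uncurry c) (x, y)).comp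
    (ContinuousLinearMap.inl ℝ (E d) (E d)) with hC'
  have hC'c : Continuous C' :=
    (continuous_partial hc).comp (by fun_prop : Continuous fun y => (x, y))
  have hp : ∀ y, (fderiv ℝ G (x, y)).comp (ContinuousLinearMap.inl ℝ (E d) (E d))
      = (G (x, y) / ε) • (fderiv ℝ f x - C' y) := fun y => by
    have h1 : HasFDerivAt f (fderiv ℝ f x) x :=
      (h.contDiff_left.differentiable (by norm_num) x).hasFDerivAt
    have h2 := (((h1.add_const (g y)).sub (hasFDerivAt_partial hc x y)).mul_const ε⁻¹).exp
    refine (hasFDerivAt_partial hGc x y).unique ?_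
    convert! h2 using 1
    rw [smul_smul]; rfl
  have h0 := (hasFDerivAt_integral_param (G := fun x y => G (x, y))
    (G' := fun x y => (fderiv ℝ G (x, y)).comp (ContinuousLinearMap.inl ℝ (E d) (E d))) hK hν
    (fun x => hGc.continuous.comp (by fun_prop)) (continuous_partial hGc)
    (hasFDerivAt_partial hGc) x)
  -- The normalization holds at every `x`, so it can be differentiated: `∇f x` is the average of `∇ₓ
  -- c (x, ·)` under the probability density `G (x, ·)`.
  have hone : (fun x => ∫ y, G (x, y) ∂ν) = fun _ => 1 := funext h.integral_snd
  rw [hone] at h0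
  have hzero := h0.unique (hasFDerivAt_const (1 : ℝ) x)
  simp_rw [hp] at hzero
  have hGx : Continuous fun y => G (x, y) := hGc.continuous.comp (by fun_prop)
  have hi1 : Integrable (fun y => G (x, y) • fderiv ℝ f x) ν :=
    integrable_of_continuous hK hν (by fun_prop)
  have hi2 : Integrable (fun y => G (x, y) • C' y) ν :=
    integrable_of_continuous hK hν (by fun_prop)
  have hf : fderiv ℝ f x = ∫ y, G (x, y) • C' y ∂ν := by
    have e : ∀ y, (G (x, y) / ε) • (fderiv ℝ f x - C' y)
        = ε⁻¹ • (G (x, y) • fderiv ℝ f x - G (x, y) • C' y) := fun y => by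
      rw [← smul_sub, smul_smul]; congr 1; ring
    simp_rw [e] at hzero
    rw [integral_smul, smul_eq_zero_iff_right (inv_ne_zero hε.ne'), integral_sub hi1 hi2,
      integral_smul_const, h.integral_snd x, one_smul, sub_eq_zero] at hzero
    exact hzero
  rw [hf]
  have hM' : ∀ᵐ y ∂ν, ‖G (x, y) • C' y‖ ≤ G (x, y) * M := by
    filter_upwards [ae_mem_of_compl_null hν] with y hy
    rw [norm_smul, Real.norm_of_nonneg (Real.exp_pos _).le]
    refine mul_le_mul_of_nonneg_left ?_ (Real.exp_pos _).le
    refine (ContinuousLinearMap.opNorm_comp_le _ _).trans ?_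
    exact (mul_le_of_le_one_right (norm_nonneg _)
      (ContinuousLinearMap.norm_inl_le_one ℝ (E d) (E d))).trans (hM y hy)
  refine (norm_integral_le_of_norm_le ((integrable_of_continuous hK hν hGx).mul_const M)
    hM').trans_eq ?_
  rw [integral_mul_const, h.integral_snd x, one_mul]

lemma integral_comap_subtype {V : Type*} [NormedAddCommGroup V] [NormedSpace ℝ V]
    (hK : IsCompact K) (hμ : μ Kᶜ = 0) (u : E d → V) :
    ∫ x : K, u x ∂(μ.comap Subtype.val) = ∫ x, u x ∂μ := by
  rw [integral_subtype_comap hK.measurableSet, restrict_eq_of_compl_null hμ]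

lemma isProbabilityMeasure_comap [IsProbabilityMeasure μ] (hK : IsCompact K) (hμ : μ Kᶜ = 0) :
    IsProbabilityMeasure (μ.comap (Subtype.val : K → E d)) := by
  refine ⟨?_⟩
  rw [(MeasurableEmbedding.subtype_coe hK.measurableSet).comap_apply, image_univ,
    Subtype.range_coe, (prob_compl_eq_zero_iff hK.measurableSet).1 hμ]

/-- The transform of a function known only on `K` is defined at every point of the space and
inherits the regularity of `c`; potentials are extended off `K` in this way. -/
lemma contDiff_softTransform (hc : ContDiff ℝ 1 (Function.uncurry c)) (hK : IsCompact K)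
    (ρ : Measure K) [IsProbabilityMeasure ρ] (g : C(K, ℝ)) :
    ContDiff ℝ 1 fun x => -(ε * Real.log (∫ y : K, Real.exp (g y - c x y / ε) ∂ρ)) := by
  have : CompactSpace K := isCompact_iff_compactSpace.1 hK
  have hc' : Continuous (Function.uncurry c) := hc.continuous
  have hcx : ∀ x, Continuous fun y : K => c x y := fun x =>
    hc'.comp (by fun_prop : Continuous fun y : K => (x, (y : E d)))
  have hcont : ∀ x, Continuous fun y : K => Real.exp (g y - c x y / ε) := fun x => by
    have := hcx x
    fun_prop
  have hpos : ∀ x, 0 < ∫ y : K, Real.exp (g y - c x y / ε) ∂ρ := fun x =>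
    integral_exp_pos (integrable_of_continuous isCompact_univ (by simp) (hcont x))
  refine (contDiff_const.mul (ContDiff.log ?_ fun x => (hpos x).ne')).neg
  refine contDiff_integral_param (G := fun x (y : K) => Real.exp (g y - c x y / ε))
    (G' := fun x (y : K) => Real.exp (g y - c x y / ε) • -((ε⁻¹) •
      ((fderiv ℝ (Function.uncurry c) (x, (y : E d))).comp
        (ContinuousLinearMap.inl ℝ (E d) (E d)))))
    isCompact_univ (by simp) hcont ?_ fun x y => ?_
  · have h1 : Continuous fun p : E d × K => c p.1 p.2 :=
      hc'.comp (by fun_prop : Continuous fun p : E d × K => (p.1, (p.2 : E d)))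
    have h2 := (continuous_partial hc).comp
      (by fun_prop : Continuous fun p : E d × K => (p.1, (p.2 : E d)))
    simp only [Function.uncurry_def]
    have h3 : Continuous fun p : E d × K => Real.exp (g p.2 - c p.1 p.2 / ε) := by fun_prop
    exact h3.smul (h2.const_smul ε⁻¹).neg
  · have h1 := ((((hasFDerivAt_partial hc x (y : E d))).mul_const ε⁻¹).const_sub (g y)).exp
    exact h1

/-- Existence of Schrödinger potentials for compactly supported measures. -/
theorem exists_isPotential (hc : ContDiff ℝ 1 (Function.uncurry c)) (hε : 0 < ε)
    [IsProbabilityMeasure μ] [IsProbabilityMeasure ν] (hK : IsCompact K)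
    (hμ : μ Kᶜ = 0) (hν : ν Kᶜ = 0) : ∃ f g, IsPotential c ε μ ν f g := by
  have : CompactSpace K := isCompact_iff_compactSpace.1 hK
  have hμp := isProbabilityMeasure_comap hK hμ
  have hνp := isProbabilityMeasure_comap hK hν
  set μK : Measure K := μ.comap Subtype.val
  set νK : Measure K := ν.comap Subtype.val
  have hc' : Continuous (Function.uncurry c) := hc.continuous
  have hc2 : Continuous fun p : K × K => c p.1 p.2 :=
    hc'.comp (by fun_prop : Continuous fun p : K × K => ((p.1 : E d), (p.2 : E d)))
  obtain ⟨f, g, hf, hg⟩ := exists_potentials_compact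
    (⟨fun p : K × K => c p.1 p.2 / ε, by fun_prop⟩ : C(K × K, ℝ)) μK νK
  simp only [ContinuousMap.coe_mk] at hf hg
  have hcf : ContDiff ℝ 1 (Function.uncurry fun y x => c x y) :=
    hc.comp (contDiff_snd.prodMk contDiff_fst)
  -- The potentials on `K` were built for the cost `c / ε`. By their equations these extensions
  -- equal `ε f` and `ε g` on `K`.
  set f' : E d → ℝ := fun x => -(ε * Real.log (∫ y : K, Real.exp (g y - c x y / ε) ∂νK)) with hf'
  set g' : E d → ℝ := fun y => -(ε * Real.log (∫ x : K, Real.exp (f x - c x y / ε) ∂μK)) with hg'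
  have hff : ∀ x : K, f' x = ε * f x := fun x => by
    simp only [hf']; rw [← hf, Real.log_exp]; ring
  have hgg : ∀ y : K, g' y = ε * g y := fun y => by
    simp only [hg']; rw [← hg, Real.log_exp]; ring
  have hposf : ∀ x, 0 < ∫ y : K, Real.exp (g y - c x y / ε) ∂νK := fun x => by
    have : Continuous fun y : K => c x y :=
      hc'.comp (by fun_prop : Continuous fun y : K => (x, (y : E d)))
    exact integral_exp_pos (integrable_of_continuous isCompact_univ (by simp) (by fun_prop))
  have hposg : ∀ y, 0 < ∫ x : K, Real.exp (f x - c x y / ε) ∂μK := fun y => by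
    have : Continuous fun x : K => c x y :=
      hc'.comp (by fun_prop : Continuous fun x : K => ((x : E d), y))
    exact integral_exp_pos (integrable_of_continuous isCompact_univ (by simp) (by fun_prop))
  refine ⟨f', g', contDiff_softTransform hc hK νK g, contDiff_softTransform hcf hK μK f,
    fun x => ?_, fun y => ?_⟩
  · rw [← integral_comap_subtype hK hν]
    have e : ∀ y : K, Real.exp ((f' x + g' y - c x y) / ε)
        = Real.exp (f' x / ε) * Real.exp (g y - c x y / ε) := fun y => by
      rw [← Real.exp_add, hgg]; congr 1; field_simp; ring
    simp_rw [e]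
    rw [integral_const_mul, ← Real.exp_log (hposf x), ← Real.exp_add, Real.exp_eq_one_iff]
    simp only [hf']; field_simp; ring
  · rw [← integral_comap_subtype hK hμ]
    have e : ∀ x : K, Real.exp ((f' x + g' y - c x y) / ε)
        = Real.exp (g' y / ε) * Real.exp (f x - c x y / ε) := fun x => by
      rw [← Real.exp_add, hff]; congr 1; field_simp; ring
    simp_rw [e]
    rw [integral_const_mul, ← Real.exp_log (hposg y), ← Real.exp_add, Real.exp_eq_one_iff]
    simp only [hg']; field_simp; ring

end Potentials

end Sinkhorn

/-! ### Closeness of measures in the norm dual to `C¹`. -/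

namespace Sinkhorn

variable {d : ℕ} {K : Set (E d)} {r : ℝ} {μ ν μ₀ ν₀ : Measure (E d)}

/-- `μ` is a probability measure concentrated on `K`, at distance at most `r` from `μ₀` in the norm
dual to the `C¹` norm on `K`. -/
structure DualClose (K : Set (E d)) (r : ℝ) (μ μ₀ : Measure (E d)) : Prop where
  prob : IsProbabilityMeasure μ
  compl_null : μ Kᶜ = 0
  abs_sub_le : ∀ (h : E d → ℝ) (B : ℝ), ContDiff ℝ 1 h → (∀ x ∈ K, |h x| ≤ B) →
    (∀ x ∈ K, ‖fderiv ℝ h x‖ ≤ B) → |∫ x, h x ∂μ - ∫ x, h x ∂μ₀| ≤ r * B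

lemma DualClose.self [IsProbabilityMeasure μ] (hμ : μ Kᶜ = 0) (hr : 0 ≤ r) :
    DualClose K r μ μ := by
  refine ⟨inferInstance, hμ, fun h B _ hB _ => ?_⟩
  obtain ⟨x, hx⟩ := (ae_mem_of_compl_null hμ).exists
  rw [sub_self, abs_zero]
  exact mul_nonneg hr ((abs_nonneg _).trans (hB x hx))

lemma abs_integral_le_of_forall_mem [IsProbabilityMeasure μ] (hμ : μ Kᶜ = 0) {h : E d → ℝ} {B : ℝ}
    (hB : ∀ x ∈ K, |h x| ≤ B) : |∫ x, h x ∂μ| ≤ B := by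
  have := norm_integral_le_of_norm_le_const (μ := μ) (f := h) (C := B)
    ((ae_mem_of_compl_null hμ).mono fun x hx => hB x hx)
  simpa using this

/-- Dual closeness does not control integrals of a merely continuous `p`, such as a derivative of a
`C¹` kernel; replacing `p` by `q` costs `η` for each of the two measures. -/
lemma DualClose.abs_sub_le_of_approx (hK : IsCompact K) [IsProbabilityMeasure ν₀]
    (hν₀ : ν₀ Kᶜ = 0) (h : DualClose K r ν ν₀) {p q : E d → ℝ} {η B : ℝ} (hp : Continuous p)
    (hq : ContDiff ℝ 1 q) (hpq : ∀ x ∈ K, |p x - q x| ≤ η) (hqB : ∀ x ∈ K, |q x| ≤ B)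
    (hqB' : ∀ x ∈ K, ‖fderiv ℝ q x‖ ≤ B) :
    |∫ x, p x ∂ν - ∫ x, p x ∂ν₀| ≤ 2 * η + r * B := by
  have := h.prob
  have h1 := abs_integral_le_of_forall_mem h.compl_null hpq
  have h2 := abs_integral_le_of_forall_mem hν₀ hpq
  have h3 := h.abs_sub_le q B hq hqB hqB'
  rw [integral_sub (integrable_of_continuous hK h.compl_null hp)
    (integrable_of_continuous hK h.compl_null hq.continuous)] at h1
  rw [integral_sub (integrable_of_continuous hK hν₀ hp)
    (integrable_of_continuous hK hν₀ hq.continuous)] at h2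
  rw [abs_le] at *
  constructor <;> linarith [h1.1, h1.2, h2.1, h2.2, h3.1, h3.2]

lemma contDiff_integral_left {G : E d × E d → ℝ} (hG : ContDiff ℝ 1 G) [IsFiniteMeasure ν]
    (hK : IsCompact K) (hν : ν Kᶜ = 0) : ContDiff ℝ 1 fun x => ∫ y, G (x, y) ∂ν :=
  contDiff_integral_param (G := fun x y => G (x, y))
    (G' := fun x y => (fderiv ℝ G (x, y)).comp (ContinuousLinearMap.inl ℝ (E d) (E d))) hK hν
    (fun x => hG.continuous.comp (by fun_prop)) (continuous_partial hG) (hasFDerivAt_partial hG)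

lemma hasFDerivAt_integral_left {G : E d × E d → ℝ} (hG : ContDiff ℝ 1 G) [IsFiniteMeasure ν]
    (hK : IsCompact K) (hν : ν Kᶜ = 0) (x : E d) :
    HasFDerivAt (fun x => ∫ y, G (x, y) ∂ν)
      (∫ y, (fderiv ℝ G (x, y)).comp (ContinuousLinearMap.inl ℝ (E d) (E d)) ∂ν) x :=
  hasFDerivAt_integral_param (G := fun x y => G (x, y))
    (G' := fun x y => (fderiv ℝ G (x, y)).comp (ContinuousLinearMap.inl ℝ (E d) (E d))) hK hν
    (fun x => hG.continuous.comp (by fun_prop)) (continuous_partial hG) (hasFDerivAt_partial hG) x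

lemma contDiff_integral_right {G : E d × E d → ℝ} (hG : ContDiff ℝ 1 G) [IsFiniteMeasure μ]
    (hK : IsCompact K) (hμ : μ Kᶜ = 0) : ContDiff ℝ 1 fun y => ∫ x, G (x, y) ∂μ :=
  contDiff_integral_left (G := fun p => G (p.2, p.1)) (hG.comp (contDiff_snd.prodMk contDiff_fst))
    hK hμ

lemma norm_fderiv_prodMk_le {G : E d × E d → ℝ} (hG : Differentiable ℝ G) (x y : E d) :
    ‖fderiv ℝ (fun y => G (x, y)) y‖ ≤ ‖fderiv ℝ G (x, y)‖ := by
  have h : HasFDerivAt (fun y => G (x, y))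
      ((fderiv ℝ G (x, y)).comp (ContinuousLinearMap.inr ℝ (E d) (E d))) y :=
    (hG (x, y)).hasFDerivAt.comp y (hasFDerivAt_prodMk_right x y)
  rw [h.fderiv]
  exact (ContinuousLinearMap.opNorm_comp_le _ _).trans (mul_le_of_le_one_right (norm_nonneg _)
    (ContinuousLinearMap.norm_inr_le_one ℝ (E d) (E d)))

lemma norm_fderiv_prodMk_left_le {G : E d × E d → ℝ} (hG : Differentiable ℝ G) (x y : E d) :
    ‖fderiv ℝ (fun x => G (x, y)) x‖ ≤ ‖fderiv ℝ G (x, y)‖ := by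
  have h : HasFDerivAt (fun x => G (x, y))
      ((fderiv ℝ G (x, y)).comp (ContinuousLinearMap.inl ℝ (E d) (E d))) x :=
    (hG (x, y)).hasFDerivAt.comp x (hasFDerivAt_prodMk_left x y)
  rw [h.fderiv]
  exact (ContinuousLinearMap.opNorm_comp_le _ _).trans (mul_le_of_le_one_right (norm_nonneg _)
    (ContinuousLinearMap.norm_inl_le_one ℝ (E d) (E d)))

/-- A `C¹` kernel integrates to `o(r)` against the product of two differences of measures that are
`r`-close in the dual `C¹` norm. -/
lemma exists_bound_second_difference (hK : IsCompact K) {G : E d × E d → ℝ} (hG : ContDiff ℝ 1 G)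
    [IsProbabilityMeasure ν₀] (hν₀ : ν₀ Kᶜ = 0) {η : ℝ} (hη : 0 < η) :
    ∃ B, 0 ≤ B ∧ ∀ r μ ν, 0 ≤ r → DualClose K r μ μ₀ → DualClose K r ν ν₀ →
      |∫ x, (∫ y, G (x, y) ∂ν - ∫ y, G (x, y) ∂ν₀) ∂μ
        - ∫ x, (∫ y, G (x, y) ∂ν - ∫ y, G (x, y) ∂ν₀) ∂μ₀| ≤ r * (2 * η + r * B) := by
  -- A smooth kernel would give `r² B`, with `B` bounding derivatives up to order two. As `G` is
  -- only `C¹`, it is replaced by a smooth `P`, whence the extra `2 * η`.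
  obtain ⟨P, hP, -, hP0, hP1⟩ := exists_smooth_approx hG (hK.prod hK) hη
  have hP' : ContDiff ℝ 1 (fderiv ℝ P) := (contDiff_infty_iff_fderiv.1 hP).2.of_le (by simp)
  have hPd : Differentiable ℝ P := hP.differentiable (by simp)
  have hPd' : Differentiable ℝ (fderiv ℝ P) := hP'.differentiable (by norm_num)
  obtain ⟨B0, hB0⟩ := (hK.prod hK).exists_bound_of_continuousOn hP.continuous.continuousOn
  obtain ⟨B1, hB1⟩ := (hK.prod hK).exists_bound_of_continuousOn hP'.continuous.continuousOn
  obtain ⟨B2, hB2⟩ := (hK.prod hK).exists_bound_of_continuousOn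
    (hP'.continuous_fderiv (by norm_num)).continuousOn
  set B := max 0 (max B0 (max B1 B2)) with hB
  have hBB0 : B0 ≤ B := by simp [hB]
  have hBB1 : B1 ≤ B := by simp [hB]
  have hBB2 : B2 ≤ B := by simp [hB]
  have hB_nonneg : 0 ≤ B := le_max_left _ _
  refine ⟨B, hB_nonneg, fun r μ ν hr hμ hν => ?_⟩
  have := hν.prob
  -- It suffices to bound the inner difference and its gradient in `x` by `2 * η + r * B` on `K`;
  -- closeness of `μ` then gives the other factor `r`.
  refine hμ.abs_sub_le _ _ ((contDiff_integral_left hG hK hν.compl_null).sub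
    (contDiff_integral_left hG hK hν₀)) (fun x hx => ?_) fun x hx => ?_
  · refine hν.abs_sub_le_of_approx hK hν₀ (hG.continuous.comp (by fun_prop))
      (q := fun y => P (x, y)) ((hP.of_le (by simp)).comp (by fun_prop))
      (fun y hy => hP0 (x, y) ⟨hx, hy⟩) (fun y hy => (hB0 (x, y) ⟨hx, hy⟩).trans hBB0)
      fun y hy => (norm_fderiv_prodMk_le hPd x y).trans ((hB1 (x, y) ⟨hx, hy⟩).trans hBB1)
  · have hd := (hasFDerivAt_integral_left hG hK hν.compl_null x).sub
      (hasFDerivAt_integral_left hG hK hν₀ x)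
    have hcont : Continuous fun y => (fderiv ℝ G (x, y)).comp
        (ContinuousLinearMap.inl ℝ (E d) (E d)) :=
      (continuous_partial hG).comp (by fun_prop : Continuous fun y => (x, y))
    have e : fderiv ℝ (fun x => ∫ y, G (x, y) ∂ν - ∫ y, G (x, y) ∂ν₀) x = _ := hd.fderiv
    rw [e]
    refine ContinuousLinearMap.opNorm_le_bound _ (by positivity) fun v => ?_
    rw [sub_apply, ContinuousLinearMap.integral_apply
      (integrable_of_continuous hK hν.compl_null hcont),
      ContinuousLinearMap.integral_apply (integrable_of_continuous hK hν₀ hcont), Real.norm_eq_abs]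
    have hv : ‖((v, 0) : E d × E d)‖ = ‖v‖ := by simp [Prod.norm_def]
    have h := hν.abs_sub_le_of_approx hK hν₀ (p := fun y => fderiv ℝ G (x, y) (v, 0))
      (q := fun y => fderiv ℝ P (x, y) (v, 0)) (η := η * ‖v‖) (B := B * ‖v‖)
      (((hG.continuous_fderiv (by norm_num)).comp (by fun_prop)).clm_apply continuous_const)
      ((hP'.comp (by fun_prop)).clm_apply contDiff_const) (fun y hy => ?_) (fun y hy => ?_)
      (fun y hy => ?_)
    · refine le_of_eq_of_le ?_ (h.trans_eq (by ring))
      simp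
    · rw [← sub_apply, ← Real.norm_eq_abs, ← hv]
      exact ContinuousLinearMap.le_of_opNorm_le _ (hP1 (x, y) ⟨hx, hy⟩) _
    · rw [← Real.norm_eq_abs, ← hv]
      exact ContinuousLinearMap.le_of_opNorm_le _ ((hB1 (x, y) ⟨hx, hy⟩).trans hBB1) _
    · have hQd : Differentiable ℝ fun p => fderiv ℝ P p ((v, 0) : E d × E d) :=
        hPd'.clm_apply (differentiable_const _)
      refine (norm_fderiv_prodMk_le hQd x y).trans ?_
      have e2 : fderiv ℝ (fun p => fderiv ℝ P p ((v, 0) : E d × E d)) (x, y)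
          = (fderiv ℝ (fderiv ℝ P) (x, y)).flip (v, 0) := by
        rw [fderiv_clm_apply (hPd' _) (differentiableAt_const _)]
        simp
      rw [e2]
      refine (ContinuousLinearMap.le_opNorm _ _).trans ?_
      rw [hv, ContinuousLinearMap.opNorm_flip]
      exact mul_le_mul_of_nonneg_right ((hB2 (x, y) ⟨hx, hy⟩).trans hBB2) (norm_nonneg _)

end Sinkhorn

/-! ### First-order expansion of the entropic cost. -/

namespace Sinkhorn

variable {d : ℕ} {c : E d → E d → ℝ} {ε : ℝ} {K : Set (E d)} {μ₀ ν₀ : Measure (E d)}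

/-- Concavity: `log` lies below its tangent at `a`. The remainder is quadratic in `δ`, so a marginal
correction of size `r` costs only `O(r²)` entropy. -/
lemma mul_log_add_le {a δ : ℝ} (ha : 0 < a) (h : 0 < a + δ) :
    (a + δ) * Real.log (a + δ) ≤ (a + δ) * Real.log a + δ + δ ^ 2 / a := by
  have h1 : Real.log (a + δ) ≤ Real.log a + δ / a := by
    have h2 := Real.log_le_sub_one_of_pos (div_pos h ha)
    rw [Real.log_div h.ne' ha.ne', add_div, div_self ha.ne'] at h2
    linarith
  calc (a + δ) * Real.log (a + δ) ≤ (a + δ) * (Real.log a + δ / a) :=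
        mul_le_mul_of_nonneg_left h1 h.le
    _ = _ := by field_simp; ring

/-- The entropic cost near a pair of measures with potentials `f` and `g`, in terms of the mass of
the kernel `exp ((f + g - c) / ε)`. -/
lemma IsPotential.abs_entropicCost_sub_le (hc : ContDiff ℝ 1 (Function.uncurry c)) (hε : 0 < ε)
    (hK : IsCompact K) {f g : E d → ℝ} (h : IsPotential c ε μ₀ ν₀ f g)
    {r b M : ℝ} {μ ν : Measure (E d)} (hμ : DualClose K r μ μ₀) (hν : DualClose K r ν ν₀)
    {G : E d × E d → ℝ} (hG : G = fun p => Real.exp ((f p.1 + g p.2 - c p.1 p.2) / ε))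
    (hb : 0 < b) (hGb : ∀ p ∈ K ×ˢ K, b ≤ G p) (hGM : ∀ p ∈ K ×ˢ K, |G p| ≤ M)
    (hGM' : ∀ p ∈ K ×ˢ K, ‖fderiv ℝ G p‖ ≤ M) (hr : 3 * (r * M) < b) :
    |entropicCost c ε μ ν - ∫ x, f x ∂μ - ∫ y, g y ∂ν + ε * (∫ p, G p ∂(μ.prod ν) - 1)|
      ≤ ε * ((3 * (r * M)) ^ 2 / b) := by
  have := hμ.prob
  have := hν.prob
  have hGc : ContDiff ℝ 1 G := hG ▸ h.contDiff_kernel hc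
  have hGcont := hGc.continuous
  have hGd : Differentiable ℝ G := hGc.differentiable (by norm_num)
  have hccont : Continuous fun p : E d × E d => c p.1 p.2 := hc.continuous
  have hfc := h.contDiff_left.continuous
  have hgc := h.contDiff_right.continuous
  have hKK := hK.prod hK
  have hnull := prod_compl_null hμ.compl_null hν.compl_null
  have hint : ∀ {u : E d × E d → ℝ}, Continuous u → Integrable u (μ.prod ν) := fun hu =>
    integrable_of_continuous hKK hnull hu
  set m := ∫ p, G p ∂(μ.prod ν) with hm
  set ρ₁ : E d → ℝ := fun x => ∫ y, G (x, y) ∂ν with hρ₁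
  set ρ₂ : E d → ℝ := fun y => ∫ x, G (x, y) ∂μ with hρ₂
  have hρ₁c : Continuous ρ₁ := (contDiff_integral_left hGc hK hν.compl_null).continuous
  have hρ₂c : Continuous ρ₂ := (contDiff_integral_right hGc hK hμ.compl_null).continuous
  have hm1 : m = ∫ x, ρ₁ x ∂μ := integral_prod _ (hint hGcont)
  have hm2 : m = ∫ y, ρ₂ y ∂ν := integral_prod_symm _ (hint hGcont)
  have hρ₁1 : ∀ x ∈ K, |ρ₁ x - 1| ≤ r * M := fun x hx => by
    have h1 : ∫ y, G (x, y) ∂ν₀ = 1 := by rw [hG]; exact h.integral_snd x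
    rw [← h1]
    exact hν.abs_sub_le _ M (hGc.comp (by fun_prop)) (fun y hy => hGM (x, y) ⟨hx, hy⟩)
      fun y hy => (norm_fderiv_prodMk_le hGd x y).trans (hGM' (x, y) ⟨hx, hy⟩)
  have hρ₂1 : ∀ y ∈ K, |ρ₂ y - 1| ≤ r * M := fun y hy => by
    have h1 : ∫ x, G (x, y) ∂μ₀ = 1 := by rw [hG]; exact h.integral_fst y
    rw [← h1]
    exact hμ.abs_sub_le (fun x => G (x, y)) M (hGc.comp (by fun_prop))
      (fun x hx => hGM (x, y) ⟨hx, hy⟩)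
      fun x hx => (norm_fderiv_prodMk_left_le hGd x y).trans (hGM' (x, y) ⟨hx, hy⟩)
  have hm3 : |m - 1| ≤ r * M := by
    have h1 := abs_integral_le_of_forall_mem hμ.compl_null hρ₁1
    rw [integral_sub (integrable_of_continuous hK hμ.compl_null hρ₁c) (integrable_const _),
      ← hm1] at h1
    simpa using h1
  -- Adding both marginal defects `1 - ρ₁`, `1 - ρ₂` and removing the doubly counted `1 - m` gives
  -- `G + δ` unit marginals under `μ` and `ν`. Each term is at most `r * M` on `K`, hence the factor
  -- `3`.
  set δ : E d × E d → ℝ := fun p => (1 - ρ₁ p.1) + (1 - ρ₂ p.2) - (1 - m) with hδ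
  have hδc : Continuous δ := by fun_prop
  have hδ3 : ∀ p ∈ K ×ˢ K, |δ p| ≤ 3 * (r * M) := fun p hp => by
    have h1 := abs_le.1 (hρ₁1 p.1 hp.1)
    have h2 := abs_le.1 (hρ₂1 p.2 hp.2)
    have h3 := abs_le.1 hm3
    simp only [hδ]
    rw [abs_le]
    constructor <;> linarith [h1.1, h1.2, h2.1, h2.2, h3.1, h3.2]
  set D : E d × E d → ℝ := fun p => G p + δ p with hD
  have hDc : Continuous D := by fun_prop
  have hDpos : ∀ x ∈ K, ∀ y ∈ K, 0 < D (x, y) := fun x hx y hy => by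
    have h1 := hGb (x, y) ⟨hx, hy⟩
    have h2 := (abs_le.1 (hδ3 (x, y) ⟨hx, hy⟩)).1
    simp only [hD]; linarith
  have hi₁ : Integrable ρ₁ μ := integrable_of_continuous hK hμ.compl_null hρ₁c
  have hi₂ : Integrable ρ₂ ν := integrable_of_continuous hK hν.compl_null hρ₂c
  have hD1 : ∀ x ∈ K, ∫ y, D (x, y) ∂ν = 1 := fun x _ => by
    have hGx : Integrable (fun y => G (x, y)) ν :=
      integrable_of_continuous hK hν.compl_null (by fun_prop)
    have e : ∀ y, D (x, y) = G (x, y) - ρ₂ y + (1 + m - ρ₁ x) := fun y => by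
      simp only [hD, hδ]; ring
    have hs : Integrable (fun y => G (x, y) - ρ₂ y) ν := hGx.sub hi₂
    simp_rw [e]
    rw [integral_add hs (integrable_const _), integral_sub hGx hi₂, ← hm2]
    simp [hρ₁]
  have hD2 : ∀ y ∈ K, ∫ x, D (x, y) ∂μ = 1 := fun y _ => by
    have hGy : Integrable (fun x => G (x, y)) μ :=
      integrable_of_continuous hK hμ.compl_null (by fun_prop)
    have e : ∀ x, D (x, y) = G (x, y) - ρ₁ x + (1 + m - ρ₂ y) := fun x => by
      simp only [hD, hδ]; ring
    have hs : Integrable (fun x => G (x, y) - ρ₁ x) μ := hGy.sub hi₁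
    simp_rw [e]
    rw [integral_add hs (integrable_const _), integral_sub hGy hi₁, ← hm1]
    simp [hρ₂]
  have hcoup := isCoupling_withDensity hDc hK hμ.compl_null hν.compl_null hDpos hD1 hD2
  have hae : ∀ᵐ p ∂(μ.prod ν), 0 < D p := by
    filter_upwards [ae_mem_of_compl_null hnull] with p hp
    exact hDpos p.1 hp.1 p.2 hp.2
  have hDf : ∀ u : E d → ℝ, Continuous u → ∫ p, D p * u p.1 ∂(μ.prod ν) = ∫ x, u x ∂μ :=
    fun u hu => by
      rw [← integral_withDensity_ofReal hDc.measurable hae, hcoup.integral_fst hu]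
  have hDg : ∀ u : E d → ℝ, Continuous u → ∫ p, D p * u p.2 ∂(μ.prod ν) = ∫ x, u x ∂ν :=
    fun u hu => by
      rw [← integral_withDensity_ofReal hDc.measurable hae, hcoup.integral_snd hu]
  have hDone : ∫ p, D p ∂(μ.prod ν) = 1 := by
    simpa using hDf (fun _ => 1) continuous_const
  have hδint : ∫ p, δ p ∂(μ.prod ν) = 1 - m := by
    have e : ∀ p, δ p = D p - G p := fun p => by simp [hD]
    simp_rw [e]
    rw [integral_sub (hint hDc) (hint hGcont), hDone]
  have hlow := dual_le_entropicCost hc.continuous hε hK hμ.compl_null hν.compl_null hfc hgc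
  have hup := entropicCost_le_of_density hc.continuous hε hDc hK hμ.compl_null hν.compl_null
    hDpos hD1 hD2
  have e : ∫ p, Real.exp ((f p.1 + g p.2 - c p.1 p.2) / ε) ∂(μ.prod ν) = m := by rw [hm, hG]
  rw [e] at hlow
  set q := (3 * (r * M)) ^ 2 / b with hq
  have hDlogc : Continuous fun p => D p * Real.log (D p) := Real.continuous_mul_log.comp hDc
  have hup2 : ∫ p, D p * c p.1 p.2 ∂(μ.prod ν) + ε * ∫ p, D p * Real.log (D p) ∂(μ.prod ν)
      ≤ ∫ x, f x ∂μ + ∫ y, g y ∂ν + ε * (1 - m) + ε * q := by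
    have e1 : ∫ p, D p * c p.1 p.2 ∂(μ.prod ν) + ε * ∫ p, D p * Real.log (D p) ∂(μ.prod ν)
        = ∫ p, (D p * c p.1 p.2 + ε * (D p * Real.log (D p))) ∂(μ.prod ν) := by
      rw [← integral_const_mul, ← integral_add (hint (by fun_prop)) (hint (by fun_prop))]
    have e2 : ∫ x, f x ∂μ + ∫ y, g y ∂ν + ε * (1 - m) + ε * q
        = ∫ p, (D p * f p.1 + D p * g p.2 + ε * δ p + ε * q) ∂(μ.prod ν) := by
      rw [integral_add (hint (by fun_prop)) (hint (by fun_prop)),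
        integral_add (hint (by fun_prop)) (hint (by fun_prop)),
        integral_add (hint (by fun_prop)) (hint (by fun_prop)),
        integral_const_mul, hδint, hDf f hfc, hDg g hgc]
      simp
    rw [e1, e2]
    refine integral_mono_ae (hint (by fun_prop)) (hint (by fun_prop)) ?_
    filter_upwards [ae_mem_of_compl_null hnull] with p hp
    have hGp : 0 < G p := hb.trans_le (hGb p hp)
    have h1 := mul_log_add_le hGp (hDpos p.1 hp.1 p.2 hp.2)
    have h2 : Real.log (G p) = (f p.1 + g p.2 - c p.1 p.2) / ε := by rw [hG, Real.log_exp]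
    have h3 : δ p ^ 2 / G p ≤ q := by
      rw [hq]
      refine div_le_div₀ (by positivity) ?_ hb (hGb p hp)
      exact sq_le_sq' (abs_le.1 (hδ3 p hp)).1 (abs_le.1 (hδ3 p hp)).2
    have h4 : D p * Real.log (D p)
        ≤ D p * ((f p.1 + g p.2 - c p.1 p.2) / ε) + δ p + q := by
      rw [← h2]; exact h1.trans (by simp only [hD]; linarith)
    have h5 := mul_le_mul_of_nonneg_left h4 hε.le
    have h6 : ε * (D p * ((f p.1 + g p.2 - c p.1 p.2) / ε) + δ p + q)
        = D p * (f p.1 + g p.2 - c p.1 p.2) + ε * δ p + ε * q := by field_simp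
    rw [h6] at h5
    linarith
  have hq0 : 0 ≤ ε * q := by positivity
  rw [abs_le]
  constructor <;> linarith

/-- First-order expansion of the entropic cost in the dual `C¹` norm. -/
lemma IsPotential.exists_radius (hc : ContDiff ℝ 1 (Function.uncurry c)) (hε : 0 < ε)
    (hK : IsCompact K) [IsProbabilityMeasure μ₀] [IsProbabilityMeasure ν₀] (hμ₀ : μ₀ Kᶜ = 0)
    (hν₀ : ν₀ Kᶜ = 0) {f g : E d → ℝ} (h : IsPotential c ε μ₀ ν₀ f g) {η : ℝ} (hη : 0 < η) :
    ∃ r₀ > 0, ∀ r μ ν, 0 ≤ r → r ≤ r₀ → DualClose K r μ μ₀ → DualClose K r ν ν₀ →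
      |entropicCost c ε μ ν - ∫ x, f x ∂μ - ∫ y, g y ∂ν| ≤ η * r := by
  set G : E d × E d → ℝ := fun p => Real.exp ((f p.1 + g p.2 - c p.1 p.2) / ε) with hG
  have hGc : ContDiff ℝ 1 G := h.contDiff_kernel hc
  have hKK := hK.prod hK
  obtain ⟨b, hb, hGb⟩ : ∃ b > 0, ∀ p ∈ K ×ˢ K, b ≤ G p :=
    hKK.exists_forall_le' hGc.continuous.continuousOn fun p _ => Real.exp_pos _
  obtain ⟨M0, hM0⟩ := hKK.exists_bound_of_continuousOn hGc.continuous.continuousOn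
  obtain ⟨M1, hM1⟩ := hKK.exists_bound_of_continuousOn
    (hGc.continuous_fderiv (by norm_num)).continuousOn
  set M := max 1 (max M0 M1) with hM
  have hM1' : 1 ≤ M := le_max_left _ _
  have hMM0 : M0 ≤ M := by simp [hM]
  have hMM1 : M1 ≤ M := by simp [hM]
  obtain ⟨B, hB, hquad⟩ := exists_bound_second_difference (μ₀ := μ₀) hK hGc hν₀
    (η := η / (4 * ε)) (by positivity)
  set A := ε * B + ε * (3 * M) ^ 2 / b with hA
  have hA0 : 0 ≤ A := by positivity
  refine ⟨min (b / (4 * M)) (η / (2 * (A + 1))), by positivity, fun r μ ν hr hr₀ hμ hν => ?_⟩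
  have hr1 : r ≤ b / (4 * M) := hr₀.trans (min_le_left _ _)
  have hr2 : r ≤ η / (2 * (A + 1)) := hr₀.trans (min_le_right _ _)
  rw [le_div_iff₀ (by positivity)] at hr1 hr2
  have := hμ.prob
  have := hν.prob
  have h1 := h.abs_entropicCost_sub_le hc hε hK hμ hν hG hb hGb
    (fun p hp => (hM0 p hp).trans hMM0) (fun p hp => (hM1 p hp).trans hMM1) (by nlinarith)
  have h2 := hquad r μ ν hr hμ hν
  -- In the expanded second difference, each of the three terms involving `μ₀` or `ν₀` equals `1`,
  -- so what remains is `m - 1`.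
  have hone : ∀ x, ∫ y, G (x, y) ∂ν₀ = 1 := h.integral_snd
  simp_rw [hone] at h2
  have hρc := (contDiff_integral_left hGc hK hν.compl_null).continuous
  rw [integral_sub (integrable_of_continuous hK hμ.compl_null hρc) (integrable_const _),
    integral_sub (integrable_of_continuous hK hμ₀ hρc) (integrable_const _),
    ← integral_prod _ (integrable_of_continuous hKK
      (prod_compl_null hμ.compl_null hν.compl_null) hGc.continuous),
    ← integral_prod _ (integrable_of_continuous hKK
      (prod_compl_null hμ₀ hν.compl_null) hGc.continuous),
    integral_prod_symm (μ := μ₀) _ (integrable_of_continuous hKK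
      (prod_compl_null hμ₀ hν.compl_null) hGc.continuous)] at h2
  have hone' : ∀ y, ∫ x, G (x, y) ∂μ₀ = 1 := h.integral_fst
  simp_rw [hone'] at h2
  simp only [integral_const, probReal_univ, smul_eq_mul, mul_one, sub_self, sub_zero] at h2
  set m := ∫ p, G p ∂(μ.prod ν)
  have h3 : ε * |m - 1| ≤ ε * (r * (2 * (η / (4 * ε)) + r * B)) :=
    mul_le_mul_of_nonneg_left h2 hε.le
  have h4 : ε * (r * (2 * (η / (4 * ε)) + r * B)) = η / 2 * r + ε * B * r * r := by
    field_simp; ring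
  have h5 : ε * ((3 * (r * M)) ^ 2 / b) = ε * (3 * M) ^ 2 / b * r * r := by ring
  have h6 : A * r * r ≤ η / 2 * r := mul_le_mul_of_nonneg_right (by nlinarith) hr
  have h7 : |ε * (m - 1)| = ε * |m - 1| := by rw [abs_mul, abs_of_pos hε]
  have h8 := abs_sub_abs_le_abs_sub (entropicCost c ε μ ν - ∫ x, f x ∂μ - ∫ y, g y ∂ν)
    (-(ε * (m - 1)))
  rw [abs_neg, sub_neg_eq_add, h7] at h8
  have h9 : A * r * r = ε * B * r * r + ε * (3 * M) ^ 2 / b * r * r := by rw [hA]; ring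
  linarith

/-- First-order expansion of the entropic cost along curves that are Lipschitz in the dual `C¹`
norm. -/
lemma IsPotential.hasDerivWithinAt_entropicCost (hc : ContDiff ℝ 1 (Function.uncurry c))
    (hε : 0 < ε) (hK : IsCompact K) {J : Set ℝ} {t C : ℝ} (ht : t ∈ J) (hC : 0 ≤ C)
    {m n : ℝ → Measure (E d)} (hm : ∀ᶠ s in 𝓝[J] t, DualClose K (C * |s - t|) (m s) (m t))
    (hn : ∀ᶠ s in 𝓝[J] t, DualClose K (C * |s - t|) (n s) (n t)) {f g : E d → ℝ}
    (h : IsPotential c ε (m t) (n t) f g) :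
    HasDerivWithinAt
      (fun s => entropicCost c ε (m s) (n s) - ∫ x, f x ∂(m s) - ∫ y, g y ∂(n s)) 0 J t := by
  have hmt := hm.self_of_nhdsWithin ht
  have hnt := hn.self_of_nhdsWithin ht
  have := hmt.prob
  have := hnt.prob
  have key : ∀ η > 0, ∀ᶠ s in 𝓝[J] t,
      |entropicCost c ε (m s) (n s) - ∫ x, f x ∂(m s) - ∫ y, g y ∂(n s)|
        ≤ η * (C * |s - t|) := fun η hη => by
    obtain ⟨r₀, hr₀, hr⟩ := h.exists_radius hc hε hK hmt.compl_null hnt.compl_null hη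
    have hlim : Tendsto (fun s => C * |s - t|) (𝓝[J] t) (𝓝 0) := by
      have : Continuous fun s => C * |s - t| := by fun_prop
      simpa using this.continuousWithinAt (s := J) (x := t) |>.tendsto
    filter_upwards [hm, hn, hlim.eventually (eventually_le_nhds hr₀)] with s h1 h2 h3
    exact hr _ _ _ (by positivity) h3 h1 h2
  -- At `s = t` the radius is `0`, and the estimate becomes exact duality.
  have hzero : entropicCost c ε (m t) (n t) - ∫ x, f x ∂(m t) - ∫ y, g y ∂(n t) = 0 := by
    have := (key 1 one_pos).self_of_nhdsWithin ht
    simpa using this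
  rw [hasDerivWithinAt_iff_isLittleO, Asymptotics.isLittleO_iff]
  intro κ hκ
  filter_upwards [key (κ / (C + 1)) (by positivity)] with s hs
  rw [hzero, smul_zero, sub_zero, sub_zero, Real.norm_eq_abs, Real.norm_eq_abs]
  refine hs.trans ?_
  rw [← mul_assoc]
  refine mul_le_mul_of_nonneg_right ?_ (abs_nonneg _)
  rw [div_mul_eq_mul_div, div_le_iff₀ (by positivity)]
  nlinarith

end Sinkhorn

/-! ### Linearization of the Sinkhorn divergence and its first variation. -/

namespace Sinkhorn

variable {d : ℕ} {c : E d → E d → ℝ} {ε : ℝ} {X K : Set (E d)} {μ μs : Measure (E d)}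

/-- `φ` is a `C¹` function that expands the Sinkhorn divergence to first order at `μ`, along curves
that are Lipschitz in the dual `C¹` norm. -/
structure IsLinearization (c : E d → E d → ℝ) (ε : ℝ) (μs μ : Measure (E d)) (φ : E d → ℝ) :
    Prop where
  contDiff : ContDiff ℝ 1 φ
  hasDerivWithinAt : ∀ {K : Set (E d)}, IsCompact K → μs Kᶜ = 0 → ∀ {J : Set ℝ} {t C : ℝ}, t ∈ J →
    0 ≤ C → ∀ {m : ℝ → Measure (E d)}, m t = μ →
    (∀ᶠ s in 𝓝[J] t, DualClose K (C * |s - t|) (m s) (m t)) →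
    HasDerivWithinAt (fun s => sinkhornDiv c ε μs (m s) - ∫ x, φ x ∂(m s)) 0 J t

/-- The potentials at the base point serve as derivatives of the cost. In `W_ε(μ, μ)` both arguments
move, so `f'` and `g'` both contribute, and they need not coincide. The gradient bound, uniform in
`μ` on `K`, controls the speed of the flow. -/
theorem exists_isLinearization (hc : ContDiff ℝ 1 (Function.uncurry c))
    (hsymm : ∀ x y, c x y = c y x) (hε : 0 < ε) (hK : IsCompact K)
    [IsProbabilityMeasure μ] [IsProbabilityMeasure μs] (hμ : μ Kᶜ = 0) (hμs : μs Kᶜ = 0) :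
    ∃ φ, IsLinearization c ε μs μ φ ∧ ∀ x M,
      (∀ y ∈ K, ‖fderiv ℝ (Function.uncurry c) (x, y)‖ ≤ M) → ‖fderiv ℝ φ x‖ ≤ 2 * M := by
  obtain ⟨f, g, hfg⟩ := exists_isPotential hc hε hK hμ hμs
  obtain ⟨f', g', hfg'⟩ := exists_isPotential hc hε hK hμ hμ
  refine ⟨fun x => f x - (f' x + g' x) / 2, ⟨?_, ?_⟩, fun x M hM => ?_⟩
  · exact hfg.contDiff_left.sub ((hfg'.contDiff_left.add hfg'.contDiff_right).div_const 2)
  · intro L hL hμsL J t C ht hC m hmt hm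
    have h1 := IsPotential.hasDerivWithinAt_entropicCost hc hε hL ht hC hm (n := fun _ => μs)
      (Eventually.of_forall fun s => DualClose.self hμsL (by positivity)) (hmt ▸ hfg)
    have h2 := IsPotential.hasDerivWithinAt_entropicCost hc hε hL ht hC hm hm (hmt ▸ hfg')
    have h3 := ((h1.sub (h2.div_const 2)).add_const (∫ y, g y ∂μs - entropicCost c ε μs μs / 2))
    rw [zero_div, sub_zero] at h3
    refine h3.congr_of_eventuallyEq_of_mem ?_ ht
    filter_upwards [hm] with s hs
    have := hs.prob
    have i1 := integrable_of_continuous hL hs.compl_null hfg.contDiff_left.continuous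
    have i2 := integrable_of_continuous hL hs.compl_null hfg'.contDiff_left.continuous
    have i3 := integrable_of_continuous hL hs.compl_null hfg'.contDiff_right.continuous
    have i4 : Integrable (fun x => (f' x + g' x) / 2) (m s) := (i2.add i3).div_const 2
    rw [integral_sub i1 i4, integral_div, integral_add i2 i3, sinkhornDiv]
    simp only [Pi.sub_apply]
    ring
  · have b1 := hfg.norm_fderiv_le hc hε hK hμs hM
    have b2 := hfg'.norm_fderiv_le hc hε hK hμ hM
    have b3 := (hfg'.swap hsymm).norm_fderiv_le hc hε hK hμ hM
    have d1 := (hfg.contDiff_left.differentiable (by norm_num) x).hasFDerivAt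
    have d2 := (hfg'.contDiff_left.differentiable (by norm_num) x).hasFDerivAt
    have d3 := (hfg'.contDiff_right.differentiable (by norm_num) x).hasFDerivAt
    have d4 : HasFDerivAt (fun x => f x - (f' x + g' x) / 2)
        (fderiv ℝ f x - (2 : ℝ)⁻¹ • (fderiv ℝ f' x + fderiv ℝ g' x)) x :=
      d1.sub ((d2.add d3).mul_const (2 : ℝ)⁻¹)
    rw [d4.fderiv]
    refine (norm_sub_le _ _).trans ?_
    rw [norm_smul, Real.norm_of_nonneg (by norm_num)]
    have := norm_add_le (fderiv ℝ f' x) (fderiv ℝ g' x)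
    linarith

section Perturbation

lemma perturb_zero (μ ν : Measure (E d)) : perturb μ ν 0 = μ := by simp [perturb]

lemma integral_perturb {μ ν : Measure (E d)} {h : E d → ℝ} (hμ : Integrable h μ)
    (hν : Integrable h ν) {r : ℝ} (hr : r ∈ Icc (0 : ℝ) 1) :
    ∫ x, h x ∂(perturb μ ν r) = ∫ x, h x ∂μ + r * (∫ x, h x ∂ν - ∫ x, h x ∂μ) := by
  rw [perturb, integral_add_measure (hμ.smul_measure ENNReal.ofReal_ne_top)
    (hν.smul_measure ENNReal.ofReal_ne_top), integral_smul_measure, integral_smul_measure,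
    ENNReal.toReal_ofReal (by linarith [hr.2]), ENNReal.toReal_ofReal hr.1]
  simp only [smul_eq_mul]; ring

lemma dualClose_perturb {μ ν : Measure (E d)} [IsProbabilityMeasure μ] [IsProbabilityMeasure ν]
    (hK : IsCompact K) (hμ : μ Kᶜ = 0) (hν : ν Kᶜ = 0) {r : ℝ} (hr : r ∈ Icc (0 : ℝ) 1) :
    DualClose K (2 * |r - 0|) (perturb μ ν r) (perturb μ ν 0) := by
  refine ⟨⟨?_⟩, ?_, fun h B hh hB _ => ?_⟩
  · simp only [perturb, Measure.add_apply, Measure.smul_apply, measure_univ, smul_eq_mul, mul_one]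
    rw [← ENNReal.ofReal_add (by linarith [hr.2]) hr.1]
    simp
  · simp [perturb, hμ, hν]
  · have h1 := abs_integral_le_of_forall_mem hμ hB
    have h2 := abs_integral_le_of_forall_mem hν hB
    rw [perturb_zero, integral_perturb (integrable_of_continuous hK hμ hh.continuous)
      (integrable_of_continuous hK hν hh.continuous) hr, add_sub_cancel_left, sub_zero, abs_mul]
    have h3 := abs_sub (∫ x, h x ∂ν) (∫ x, h x ∂μ)
    nlinarith [abs_nonneg r]

/-- The segment from `μ` to `ν` is `2`-Lipschitz in the dual norm on a compact set carrying all the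
measures, so the linearization applies to it. -/
lemma IsLinearization.isFirstVariation {φ : E d → ℝ} (h : IsLinearization c ε μs μ φ)
    (hμs : MemP X μs) (hμ : MemP X μ) : IsFirstVariation X (sinkhornDiv c ε μs) μ φ := by
  have hφ := h.contDiff.continuous
  have hint : ∀ ν, MemP X ν → Integrable φ ν := by
    rintro ν ⟨hν, L, -, hL, hνL⟩
    exact integrable_of_continuous hL hνL hφ
  refine ⟨hint, fun ν hν => ?_⟩
  have iμ := hint μ hμ
  have iν := hint ν hν
  obtain ⟨hp, K, -, hK, hμK⟩ := hμ
  obtain ⟨hps, Ks, -, hKs, hμsK⟩ := hμs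
  obtain ⟨hpν, L, -, hL, hνL⟩ := hν
  have mono : ∀ {ρ : Measure (E d)} {A : Set (E d)}, ρ Aᶜ = 0 → A ⊆ K ∪ Ks ∪ L →
      ρ (K ∪ Ks ∪ L)ᶜ = 0 := fun h0 hA => measure_mono_null (compl_subset_compl.2 hA) h0
  have hC := (hK.union hKs).union hL
  have hsmall : ∀ᶠ r in 𝓝[Ici (0 : ℝ)] 0, r ∈ Icc (0 : ℝ) 1 := Icc_mem_nhdsGE one_pos
  have h1 := h.hasDerivWithinAt hC (mono hμsK (by intro x; simp; tauto)) (J := Ici 0) (t := 0)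
    (C := 2) self_mem_Ici (by norm_num) (perturb_zero μ ν)
    (hsmall.mono fun r hr => dualClose_perturb hC (mono hμK (by intro x; simp; tauto))
      (mono hνL (by intro x; simp; tauto)) hr)
  have h2 : HasDerivWithinAt (fun r : ℝ => ∫ x, φ x ∂μ + r * (∫ x, φ x ∂ν - ∫ x, φ x ∂μ))
      (∫ x, φ x ∂ν - ∫ x, φ x ∂μ) (Ici 0) 0 := by
    have := ((hasDerivWithinAt_id (0 : ℝ) (Ici 0)).mul_const
      (∫ x, φ x ∂ν - ∫ x, φ x ∂μ)).const_add (∫ x, φ x ∂μ)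
    simpa using this
  have h3 := h1.add h2
  rw [zero_add] at h3
  refine h3.congr_of_eventuallyEq_of_mem ?_ self_mem_Ici
  filter_upwards [hsmall] with r hr
  simp only [Pi.add_apply]
  rw [integral_perturb iμ iν hr]
  ring

end Perturbation

/-- Testing with the Dirac mass at `x` and using uniqueness of one-sided derivatives determines `φ x
- ∫ φ dμ`. -/
lemma IsFirstVariation.eq_add_const {F : Measure (E d) → ℝ} {φ ψ : E d → ℝ}
    (hφ : IsFirstVariation X F μ φ) (hψ : IsFirstVariation X F μ ψ) :
    ∃ k, ∀ x ∈ X, ψ x = φ x + k := by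
  refine ⟨∫ x, ψ x ∂μ - ∫ x, φ x ∂μ, fun x hx => ?_⟩
  have hx' : MemP X (Measure.dirac x) :=
    ⟨inferInstance, {x}, singleton_subset_iff.2 hx, isCompact_singleton, by simp⟩
  have := (uniqueDiffOn_Ici (0 : ℝ) 0 self_mem_Ici).eq_deriv _ (hφ.2 _ hx') (hψ.2 _ hx')
  rw [integral_dirac, integral_dirac] at this
  linarith

lemma isFirstVariation_firstVariation {F : Measure (E d) → ℝ} {φ : E d → ℝ}
    (hφ : IsFirstVariation X F μ φ) : IsFirstVariation X F μ (firstVariation X F μ) := by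
  have h : ∃ φ, IsFirstVariation X F μ φ := ⟨φ, hφ⟩
  rw [firstVariation, dif_pos h]
  exact h.choose_spec

lemma IsFirstVariation.differentiableOn {F : Measure (E d) → ℝ} {φ : E d → ℝ}
    (hφ : IsFirstVariation X F μ φ) (hd : Differentiable ℝ φ) :
    DifferentiableOn ℝ (firstVariation X F μ) X := by
  obtain ⟨k, hk⟩ := hφ.eq_add_const (isFirstVariation_firstVariation hφ)
  exact (hd.differentiableOn.add_const k).congr hk

/-- The chosen representative differs from `φ` by a constant on `X`, and derivatives within `X` are
unique, so the abstract gradient is that of the explicit `C¹` function. -/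
lemma IsFirstVariation.wassersteinGrad_eq (hX : UniqueDiffOn ℝ X) {F : Measure (E d) → ℝ}
    {φ : E d → ℝ} (hφ : IsFirstVariation X F μ φ) (hd : Differentiable ℝ φ) {x : E d}
    (hx : x ∈ X) : wassersteinGrad X F μ x = gradient φ x := by
  obtain ⟨k, hk⟩ := hφ.eq_add_const (isFirstVariation_firstVariation hφ)
  rw [wassersteinGrad, gradientWithin, gradient, fderivWithin_congr hk (hk x hx),
    fderivWithin_add_const, (hd x).fderivWithin (hX x hx)]

/-! ### Regularity of the flow in time and testing with `C¹` functions. -/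

lemma inner_gradient_eq (u : E d → ℝ) (w x : E d) :
    inner ℝ w (gradient u x) = fderiv ℝ u x w := by
  rw [real_inner_comm, gradient, InnerProductSpace.toDual_symm_apply]

lemma norm_gradient (u : E d → ℝ) (x : E d) : ‖gradient u x‖ = ‖fderiv ℝ u x‖ := by
  rw [gradient, LinearIsometryEquiv.norm_map]

/-- The weak formulation extends from test functions to `C¹` functions. -/
lemma hasDerivWithinAt_integral_of_weak (hK : IsCompact K) {J : Set ℝ} {t C : ℝ} (ht : t ∈ J)
    (hC : 0 ≤ C) {m : ℝ → Measure (E d)}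
    (hm : ∀ᶠ s in 𝓝[J] t, DualClose K (C * |s - t|) (m s) (m t)) {w : E d → E d}
    (hw : Continuous w)
    (hweak : ∀ h : E d → ℝ, ContDiff ℝ ∞ h → HasCompactSupport h →
      HasDerivWithinAt (fun s => ∫ x, h x ∂(m s)) (-∫ x, fderiv ℝ h x (w x) ∂(m t)) J t)
    {u : E d → ℝ} (hu : ContDiff ℝ 1 u) :
    HasDerivWithinAt (fun s => ∫ x, u x ∂(m s)) (-∫ x, fderiv ℝ u x (w x) ∂(m t)) J t := by
  have hmt := hm.self_of_nhdsWithin ht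
  have := hmt.prob
  obtain ⟨W, hW⟩ := hK.exists_bound_of_continuousOn hw.continuousOn
  obtain ⟨x₀, hx₀⟩ := (ae_mem_of_compl_null hmt.compl_null).exists
  have hW0 : 0 ≤ W := (norm_nonneg _).trans (hW x₀ hx₀)
  rw [hasDerivWithinAt_iff_isLittleO, Asymptotics.isLittleO_iff]
  intro κ hκ
  -- Three errors share `κ * |s - t|`: `C` for integrating `u - h` against `m s - m t`, where the
  -- Lipschitz bound supplies `|s - t|`; `W` for exchanging the derivatives of `u` and `h`; `1` for
  -- the weak equation tested with `h`.
  set η := κ / (C + W + 1) with hη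
  have hη0 : 0 < η := by positivity
  obtain ⟨h, hh, hhc, h0, h1⟩ := exists_smooth_approx hu hK hη0
  have hh1 : ContDiff ℝ 1 h := hh.of_le (by simp)
  have hweak' := hweak h hh hhc
  rw [hasDerivWithinAt_iff_isLittleO, Asymptotics.isLittleO_iff] at hweak'
  have hder : |∫ x, fderiv ℝ u x (w x) ∂(m t) - ∫ x, fderiv ℝ h x (w x) ∂(m t)| ≤ η * W := by
    rw [← integral_sub (integrable_of_continuous hK hmt.compl_null
        ((hu.continuous_fderiv (by norm_num)).clm_apply hw))
      (integrable_of_continuous hK hmt.compl_null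
        ((hh1.continuous_fderiv (by norm_num)).clm_apply hw))]
    refine abs_integral_le_of_forall_mem hmt.compl_null fun x hx => ?_
    rw [← sub_apply, ← Real.norm_eq_abs]
    exact (ContinuousLinearMap.le_of_opNorm_le _ (h1 x hx) _).trans
      (mul_le_mul_of_nonneg_left (hW x hx) hη0.le)
  filter_upwards [hm, hweak' hη0] with s hs hs'
  have := hs.prob
  have hdiff := hs.abs_sub_le (fun x => u x - h x) η (hu.sub hh1) h0 fun x hx => by
    have e : fderiv ℝ (fun x => u x - h x) x = fderiv ℝ u x - fderiv ℝ h x :=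
      fderiv_fun_sub (hu.differentiable (by norm_num) x) (hh1.differentiable (by norm_num) x)
    rw [e]; exact h1 x hx
  rw [integral_sub (integrable_of_continuous hK hs.compl_null hu.continuous)
      (integrable_of_continuous hK hs.compl_null hh1.continuous),
    integral_sub (integrable_of_continuous hK hmt.compl_null hu.continuous)
      (integrable_of_continuous hK hmt.compl_null hh1.continuous)] at hdiff
  simp only [smul_eq_mul, Real.norm_eq_abs] at hs' ⊢
  set Du := ∫ x, fderiv ℝ u x (w x) ∂(m t)
  set Dh := ∫ x, fderiv ℝ h x (w x) ∂(m t)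
  have hmul : |(s - t) * (Du - Dh)| ≤ |s - t| * (η * W) := by
    rw [abs_mul]; exact mul_le_mul_of_nonneg_left hder (abs_nonneg _)
  have hκ' : κ * |s - t| = C * |s - t| * η + η * |s - t| + |s - t| * (η * W) := by
    have : κ = η * (C + W + 1) := by rw [hη]; field_simp
    rw [this]; ring
  rw [hκ']
  rw [abs_le] at hdiff hs' hmul ⊢
  constructor <;> linarith [hdiff.1, hdiff.2, hs'.1, hs'.2, hmul.1, hmul.2]

/-- A gradient flow is Lipschitz in the dual `C¹` norm, locally in time. -/
lemma IsGradientFlow.exists_dualClose (hX : UniqueDiffOn ℝ X)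
    (hc : ContDiff ℝ 1 (Function.uncurry c)) (hsymm : ∀ x y, c x y = c y x) (hε : 0 < ε)
    (hμs : MemP X μs) {J : Set ℝ} (hJ : J.OrdConnected) {m : ℝ → Measure (E d)}
    (hflow : IsGradientFlow X (sinkhornDiv c ε μs) J m) {t : ℝ} (ht : t ∈ J) :
    ∃ K ⊆ X, IsCompact K ∧ μs Kᶜ = 0 ∧ ∃ C, 0 ≤ C ∧
      ∀ᶠ s in 𝓝[J] t, DualClose K (C * |s - t|) (m s) (m t) := by
  obtain ⟨K₀, hK₀X, hK₀, hsupp⟩ := hflow.supp t ht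
  have hμs' := hμs
  obtain ⟨hps, Ks, hKsX, hKs, hμsK⟩ := hμs'
  set K := K₀ ∪ Ks with hKdef
  have hKX : K ⊆ X := union_subset hK₀X hKsX
  have hK : IsCompact K := hK₀.union hKs
  have hμsK' : μs Kᶜ = 0 := measure_mono_null (compl_subset_compl.2 subset_union_right) hμsK
  obtain ⟨M, hM⟩ := (hK.prod hK).exists_bound_of_continuousOn
    (hc.continuous_fderiv (by norm_num)).continuousOn
  obtain ⟨x₀, hx₀⟩ := (ae_mem_of_compl_null hμsK').exists
  have hM0 : 0 ≤ M := (norm_nonneg _).trans (hM (x₀, x₀) ⟨hx₀, hx₀⟩)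
  refine ⟨K, hKX, hK, hμsK', 2 * M, by positivity, ?_⟩
  obtain ⟨δ, hδ, hball⟩ := Metric.mem_nhdsWithin_iff.1 hsupp
  have hnull : ∀ s ∈ Metric.ball t δ ∩ J, m s Kᶜ = 0 := fun s hs =>
    measure_mono_null (compl_subset_compl.2 subset_union_left) (hball hs)
  have hgrad : ∀ s ∈ Metric.ball t δ ∩ J, ∀ x ∈ K,
      ‖wassersteinGrad X (sinkhornDiv c ε μs) (m s) x‖ ≤ 2 * M := fun s hs x hx => by
    have := hflow.prob s hs.2
    obtain ⟨φ, hφ, hb⟩ := exists_isLinearization hc hsymm hε hK (hnull s hs) hμsK'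
    rw [(hφ.isFirstVariation hμs ⟨this, K, hKX, hK, hnull s hs⟩).wassersteinGrad_eq hX
      (hφ.contDiff.differentiable (by norm_num)) (hKX hx), norm_gradient]
    exact hb x M fun y hy => hM (x, y) ⟨hx, hy⟩
  have htb : t ∈ Metric.ball t δ ∩ J := ⟨Metric.mem_ball_self hδ, ht⟩
  -- Convexity allows the mean value inequality in time, which turns the velocity bound `2 * M` into
  -- a Lipschitz bound on integrals of test functions.
  have hconv : Convex ℝ (Metric.ball t δ ∩ J) := (convex_ball t δ).inter hJ.convex
  have hsmooth : ∀ h : E d → ℝ, ContDiff ℝ ∞ h → HasCompactSupport h → ∀ B,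
      (∀ x ∈ K, ‖fderiv ℝ h x‖ ≤ B) → ∀ s ∈ Metric.ball t δ ∩ J,
      |∫ x, h x ∂(m s) - ∫ x, h x ∂(m t)| ≤ 2 * M * B * |s - t| := by
    intro h hh hhc B hB s hs
    refine hconv.norm_image_sub_le_of_norm_hasDerivWithin_le (f := fun s => ∫ x, h x ∂(m s))
      (fun z hz => (hflow.weak h hh hhc z hz.2).mono inter_subset_right) (fun z hz => ?_) htb hs
    have := hflow.prob z hz.2
    rw [norm_neg, Real.norm_eq_abs]
    refine abs_integral_le_of_forall_mem (hnull z hz) fun x hx => ?_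
    refine (abs_real_inner_le_norm _ _).trans ?_
    rw [norm_gradient]
    exact mul_le_mul (hgrad z hz x hx) (hB x hx) (norm_nonneg _) (by positivity)
  filter_upwards [inter_mem_nhdsWithin J (Metric.ball_mem_nhds t hδ)] with s hs
  rw [inter_comm] at hs
  have := hflow.prob s hs.2
  have := hflow.prob t ht
  refine ⟨hflow.prob s hs.2, hnull s hs, fun u B hu _ hB => ?_⟩
  refine le_of_forall_pos_le_add fun e he => ?_
  -- With approximation error `e / A`, the two integrals of `u - h` cost `2 * (e / A)` and the
  -- larger gradient bound costs `2 * M * |s - t| * (e / A)`, in total `e`.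
  set A := 2 + 2 * M * |s - t| with hA
  have hA0 : 0 < A := by positivity
  obtain ⟨h, hh, hhc, h0, h1⟩ := exists_smooth_approx hu hK (η := e / A) (by positivity)
  have b1 := hsmooth h hh hhc (B + e / A) (fun x hx => by
    have e1 := norm_sub_norm_le (fderiv ℝ h x) (fderiv ℝ u x)
    rw [norm_sub_rev] at e1
    linarith [h1 x hx, hB x hx]) s hs
  have b2 := abs_integral_le_of_forall_mem (hnull s hs) h0
  have b3 := abs_integral_le_of_forall_mem (hnull t htb) h0
  rw [integral_sub (integrable_of_continuous hK (hnull s hs) hu.continuous)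
    (integrable_of_continuous hK (hnull s hs) hh.continuous)] at b2
  rw [integral_sub (integrable_of_continuous hK (hnull t htb) hu.continuous)
    (integrable_of_continuous hK (hnull t htb) hh.continuous)] at b3
  have hAe : e = e / A * (2 + 2 * M * |s - t|) := by rw [← hA]; field_simp
  have hb : 2 * M * (B + e / A) * |s - t| = 2 * M * |s - t| * B + e / A * (2 * M * |s - t|) := by
    ring
  rw [hb] at b1
  rw [abs_le] at b1 b2 b3 ⊢
  constructor <;> linarith [b1.1, b1.2, b2.1, b2.2, b3.1, b3.2]

end Sinkhorn

/-! ### The descending property. -/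

open Sinkhorn

theorem mainTheorem4 {d : ℕ} (X : Set (Sinkhorn.E d)) (hX : UniqueDiffOn ℝ X)
    (c : Sinkhorn.E d → Sinkhorn.E d → ℝ) (hc : ContDiff ℝ 1 (Function.uncurry c))
    (hsymm : ∀ x y, c x y = c y x)
    (ε : ℝ) (hε : 0 < ε)
    (μs : Measure (Sinkhorn.E d)) (hμs : Sinkhorn.MemP X μs)
    (J : Set ℝ) (hJ : J.OrdConnected)
    (μ : ℝ → Measure (Sinkhorn.E d))
    (hflow : Sinkhorn.IsGradientFlow X (Sinkhorn.sinkhornDiv c ε μs) J μ) :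
    (∀ t ∈ J,
      Sinkhorn.IsFirstVariation X (Sinkhorn.sinkhornDiv c ε μs) (μ t)
        (Sinkhorn.firstVariation X (Sinkhorn.sinkhornDiv c ε μs) (μ t)) ∧
      DifferentiableOn ℝ (Sinkhorn.firstVariation X (Sinkhorn.sinkhornDiv c ε μs) (μ t)) X ∧
      Integrable
        (fun x => ‖Sinkhorn.wassersteinGrad X (Sinkhorn.sinkhornDiv c ε μs) (μ t) x‖ ^ 2) (μ t) ∧
      HasDerivWithinAt (fun s => Sinkhorn.sinkhornDiv c ε μs (μ s))
        (-∫ x, ‖Sinkhorn.wassersteinGrad X (Sinkhorn.sinkhornDiv c ε μs) (μ t) x‖ ^ 2 ∂(μ t))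
        J t ∧
      -∫ x, ‖Sinkhorn.wassersteinGrad X (Sinkhorn.sinkhornDiv c ε μs) (μ t) x‖ ^ 2 ∂(μ t) ≤ 0) ∧
    AntitoneOn (fun t => Sinkhorn.sinkhornDiv c ε μs (μ t)) J := by
  have main : ∀ t ∈ J,
      IsFirstVariation X (sinkhornDiv c ε μs) (μ t)
        (firstVariation X (sinkhornDiv c ε μs) (μ t)) ∧
      DifferentiableOn ℝ (firstVariation X (sinkhornDiv c ε μs) (μ t)) X ∧
      Integrable (fun x => ‖wassersteinGrad X (sinkhornDiv c ε μs) (μ t) x‖ ^ 2) (μ t) ∧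
      HasDerivWithinAt (fun s => sinkhornDiv c ε μs (μ s))
        (-∫ x, ‖wassersteinGrad X (sinkhornDiv c ε μs) (μ t) x‖ ^ 2 ∂(μ t)) J t ∧
      -∫ x, ‖wassersteinGrad X (sinkhornDiv c ε μs) (μ t) x‖ ^ 2 ∂(μ t) ≤ 0 := by
    intro t ht
    obtain ⟨K, hKX, hK, hμsK, C, hC, hclose⟩ := hflow.exists_dualClose hX hc hsymm hε hμs hJ ht
    have hnull := (hclose.self_of_nhdsWithin ht).compl_null
    have := hflow.prob t ht
    have := hμs.1
    obtain ⟨φ, hφ, -⟩ := exists_isLinearization hc hsymm hε hK hnull hμsK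
    have hfv := hφ.isFirstVariation hμs ⟨hflow.prob t ht, K, hKX, hK, hnull⟩
    have hd : Differentiable ℝ φ := hφ.contDiff.differentiable (by norm_num)
    have hgc : Continuous (gradient φ) :=
      (InnerProductSpace.toDual ℝ (E d)).symm.continuous.comp
        (hφ.contDiff.continuous_fderiv (by norm_num))
    have hgrad : ∀ᵐ x ∂(μ t), wassersteinGrad X (sinkhornDiv c ε μs) (μ t) x = gradient φ x := by
      filter_upwards [ae_mem_of_compl_null hnull] with x hx
      exact hfv.wassersteinGrad_eq hX hd (hKX hx)
    have hsq : (fun x => ‖wassersteinGrad X (sinkhornDiv c ε μs) (μ t) x‖ ^ 2)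
        =ᵐ[μ t] fun x => ‖gradient φ x‖ ^ 2 := by
      filter_upwards [hgrad] with x hx
      rw [hx]
    refine ⟨isFirstVariation_firstVariation hfv, hfv.differentiableOn hd, ?_, ?_,
      neg_nonpos.2 (integral_nonneg fun x => by positivity)⟩
    · rw [integrable_congr hsq]
      exact integrable_of_continuous hK hnull (by fun_prop)
    · have h1 := hφ.hasDerivWithinAt hK hμsK ht hC rfl hclose
      have h2 := hasDerivWithinAt_integral_of_weak hK ht hC hclose hgc (fun h hh hhc => by
        convert hflow.weak h hh hhc t ht using 2
        refine integral_congr_ae ?_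
        filter_upwards [hgrad] with x hx
        rw [hx, inner_gradient_eq]) hφ.contDiff
      have h3 := h1.add h2
      rw [integral_congr_ae hsq]
      convert! h3 using 1
      · ext s
        simp
      · simp_rw [zero_add, ← inner_gradient_eq, real_inner_self_eq_norm_sq]
  refine ⟨main, ?_⟩
  have hder := fun t ht => (main t ht).2.2.2.1
  refine antitoneOn_of_deriv_nonpos hJ.convex (fun t ht => (hder t ht).continuousWithinAt)
    (fun t ht => ((hder t (interior_subset ht)).hasDerivAt
      (mem_interior_iff_mem_nhds.1 ht)).differentiableAt.differentiableWithinAt) fun t ht => ?_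
  rw [((hder t (interior_subset ht)).hasDerivAt (mem_interior_iff_mem_nhds.1 ht)).deriv]
  exact (main t (interior_subset ht)).2.2.2.2
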